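/- **Setting.** Let $\mathbf H$ be a function on $\omega$ with $|\mathbf H(m)|\ge 2$ for all $m$. A *creature* $t$ for $\mathbf H$ is a triple $(\mathrm{nor}[t],\mathrm{val}[t],\mathrm{dis}[t])$ with $\mathrm{nor}[t]\in\mathbb R^{\ge 0}$, $\mathrm{dis}[t]$ an arbitrary parameter, and $\mathrm{val}[t]$ a non-empty set of pairs $\langle x,y\rangle$ with $x$ a proper initial segment of $y$, where, for some numbers $m^t_{\rm dn}<m^t_{\rm up}$, always $x\in\prod_{i<m^t_{\rm dn}}\mathbf H(i)$ and $y\in\prod_{i<m^t_{\rm up}}\mathbf H(i)$. Call $t_0,\dots,t_n$ *linked* if $m^{t_i}_{\rm up}=m^{t_{i+1}}_{\rm dn}$ for $i<n$; for linked sequences write $\Sigma(t_0,\dots,t_n)$ for $\Sigma(\{t_0,\dots,t_n\})$, and similarly for $\mathrm{pos}$. A *creating pair* $(K,\Sigma)$ for $\mathbf H$ consists of a set $K$ of creatures and a map $\Sigma:[K]^{\le\omega}\to\mathcal P(K)$ such that $\Sigma(\emptyset)=\emptyset$; $r\in\Sigma(r)$ for $r\in K$; if $s\in\Sigma(\mathcal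 S_s)$ for all $s\in\mathcal S$ then $\Sigma(\mathcal S)\subseteq\Sigma(\bigcup_{s\in\mathcal S}\mathcal S_s)$; if $\Sigma(\mathcal S)\ne\emptyset$ then $\mathcal S$ is finite and can be enumerated as a linked sequence; and if $s\in\Sigma(t_0,\dots,t_n)$ (with $t_0,\dots,t_n$ linked) then $m^s_{\rm dn}=m^{t_0}_{\rm dn}$ and $m^s_{\rm up}=m^{t_n}_{\rm up}$. Put $\mathrm{basis}(t)=\{x:\exists s\in\Sigma(t)\,\exists u\ \langle x,u\rangle\in\mathrm{val}[s]\}$, $\mathrm{pos}^*(x,\mathcal S)=\{u:\exists s\in\Sigma(\mathcal S)\ \langle x,u\rangle\in\mathrm{val}[s]\}$, and let $\mathrm{pos}(x,\mathcal S)$ be the set of those $u$ for which there are pairwise disjoint $\mathcal S_0,\dots,\mathcal S_{m-1}$ with union $\mathcal S$ and $x=u_0,u_1,\dots,u_m=u$ with $u_{i+1}\in\mathrm{pos}^*(u_i,\mathcal S_i)$ for $i<m$ (so $\mathrm{pos}(x,\emptyset)=\{x\}$). A *finite candidate* is $(x,t_0,\dots,t_n)$ with $t_0,\dots,t_n\in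 K$ linked, $x\in\mathrm{basis}(t_0)$ and $\mathrm{pos}(x,t_0,\dots,t_i)\subseteq\mathrm{basis}(t_{i+1})$ for $i<n$; then $(t_0,\dots,t_n)$ is a *pure finite candidate*. Creating pairs are always assumed to be *nice* ($s\in\Sigma(t_0,\dots,t_n)$ implies $\mathrm{basis}(t_0)\subseteq\mathrm{basis}(s)$) and *smooth* (if $(x,t_0,\dots,t_{n-1})$ is a finite candidate, $m<n$ and $u\in\mathrm{pos}(x,t_0,\dots,t_{n-1})$, then $u{\restriction}m^{t_m}_{\rm dn}\in\mathrm{pos}(x,t_0,\dots,t_{m-1})$ and $u\in\mathrm{pos}(u{\restriction}m^{t_m}_{\rm dn},t_m,\dots,t_{n-1})$). The pair $(K,\Sigma)$ is * *finitary* if all $\mathbf H(n)$ and all $\mathrm{val}[t]$, $t\in K$, are finite; * *$\bar 2$-big* if for all $t\in K$ with $\mathrm{nor}[t]>1$, $u\in\mathrm{basis}(t)$ and $c:\mathrm{pos}(u,t)\to 2$ there is $s\in\Sigma(t)$ with $\mathrm{nor}[s]\ge\mathrm{nor}[t]-1$ and $c{\restriction}\mathrm{pos}(u,s)$ constant; *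 *simple* if $\Sigma(\mathcal S)\neq\emptyset$ only for singletons $\mathcal S$; * *gluing* if $\{x:\exists u\ \langle x,u\rangle\in\mathrm{val}[t]\}=\prod_{i<m^t_{\rm dn}}\mathbf H(i)$ for all $t\in K$, and for every $k<\omega$ there is $n_0$ such that for every $n\ge n_0$ and every pure finite candidate $(t_0,\dots,t_n)$ there is $s\in\Sigma(t_0,\dots,t_n)$ with $\mathrm{nor}[s]\ge\min\{k,\mathrm{nor}[t_0],\dots,\mathrm{nor}[t_n]\}$. It has the *Halving Property* if there is $\mathrm{half}:K\to K$ with $\mathrm{half}(t)\in\Sigma(t)$ and $\mathrm{nor}[\mathrm{half}(t)]\ge\frac12\mathrm{nor}[t]$ for all $t\in K$, such that whenever $t_0,\dots,t_n\in K$ are linked and have norms $\ge2$, $t\in\Sigma(\mathrm{half}(t_0),\dots,\mathrm{half}(t_n))$ and $\mathrm{nor}[t]>0$, there is $s\in\Sigma(t_0,\dots,t_n)$ with $\mathrm{nor}[s]\ge\min_{i\le n}\frac12\mathrm{nor}[t_i]$ and $\mathrm{pos}(u,s)\subseteq\mathrm{pos}(u,t)$ for all $u\in\mathrm{basis}(t_0)$.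 A function $f:\omega\times\omega\to\omega$ is *$\mathbf H$-fast* if $\mathbf H$ is finitary and for all $k,\ell$: $f(k,\ell)\le f(k,\ell+1)$, $2f(k,\ell)<f(k+1,\ell)$ and $2^{\varphi(\ell)}(f(k,\ell)+\varphi(\ell)+2)<f(k+1,\ell)$, where $\varphi(\ell)=|\prod_{i<\ell}\mathbf H(i)|$. Conditions of $\mathbb Q^*_f(K,\Sigma)$ are the sequences $p=(w^p,t^p_0,t^p_1,\dots)$ such that all $t^p_i\in K$, $m^{t^p_i}_{\rm up}=m^{t^p_{i+1}}_{\rm dn}$, $w^p\in\mathrm{basis}(t^p_0)$, for every $I\subseteq\omega$ and $u\in\mathrm{pos}(w^p,\{t^p_i:i\in I\})$ there is $i\notin I$ with $u\in\mathrm{basis}(t^p_i)$, and for every $k$, $\mathrm{nor}[t^p_i]>f(k,m^{t^p_i}_{\rm dn})$ for all but finitely many $i$. The order (larger is stronger) is: $p\le q$ iff there are pairwise disjoint $S_0,S_1,\dots\subseteq\omega$ with $w^q\in\mathrm{pos}(w^p,\{t^p_\ell:\ell\in S_0\})$ and $t^q_i\in\Sigma(\{t^p_\ell:\ell\in S_{i+1}\})$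 for all $i$. Further, $p\le^f_0q$ iff $p\le q$ and $w^p=w^q$; and $p\le^f_{n+1}q$ iff $p\le^f_0q$, $t^p_j=t^q_j$ for all $j\le\min\{i:\mathrm{nor}[t^p_i]>f(n+1,m^{t^p_i}_{\rm dn})\}$, and $\{t^q_i:\mathrm{nor}[t^q_i]\le f(n+1,m^{t^q_i}_{\rm dn})\}\subseteq\{t^p_i:i<\omega\}$. A condition $p$ *essentially decides* a name $\dot\tau$ for an ordinal if for some $m$ and all $u\in\mathrm{pos}(w^p,t^p_0,\dots,t^p_{m-1})$ the condition $(u,t^p_m,t^p_{m+1},\dots)$ decides the value of $\dot\tau$. A forcing notion $\mathbb P$ is *proper* if for club many countable $N\subseteq\mathbb P\cup\mathcal P(\mathbb P)$, every $p\in\mathbb P\cap N$ has an extension $q\ge p$ that is $(N,\mathbb P)$-generic, i.e. for each dense $D\subseteq\mathbb P$ with $D\in N$, the set $D\cap N$ is predense above $q$. **Theorem.** Let $(K,\Sigma)$ be a finitary, $\bar2$-big creating pair for $\mathbf H$ with the Halving Property which is simple or gluing, and let $f:\omega\times\omega\to\omega$ be $\mathbf H$-fast. Then: 1. for all $\mathbb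 Q^*_f(K,\Sigma)$-names $\dot\tau_m$ ($m<\omega$) for ordinals, all $p\in\mathbb Q^*_f(K,\Sigma)$ and all $n<\omega$ there is $q\in\mathbb Q^*_f(K,\Sigma)$ such that $p\le^f_nq$ and $q$ essentially decides every $\dot\tau_m$; 2. the forcing notion $\mathbb Q^*_f(K,\Sigma)$ is proper. -/

import Mathlib

/-! # Creating pairs, the forcing notions `Q*_f(K, Σ)`, and properness -/

universe u v w

namespace Creatures

section Sequences

variable {α : Type u}

/-- `w` is an element of `∏_{i < m} H(i)`, where `m` is the length of `w`. -/
def IsSeq (H : ℕ → Set α) (w : List α) : Prop :=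
  ∀ (i : ℕ) (h : i < w.length), w[i] ∈ H i

/-- `φ_H(l)`, the number of elements of `∏_{i < l} H(i)`. -/
noncomputable def phi (H : ℕ → Set α) (l : ℕ) : ℕ :=
  Set.ncard {w : List α | IsSeq H w ∧ w.length = l}

/-- Each `H(n)` is finite. -/
def IsFinitarySeq (H : ℕ → Set α) : Prop :=
  ∀ n, (H n).Finite

/-- `f` is fast. -/
def IsFast (f : ℕ → ℕ → ℕ) : Prop :=
  ∀ k l, f k l ≤ f k (l + 1) ∧ 2 * f k l < f (k + 1) l

/-- `f` is `H`-fast. -/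
def IsHFast (H : ℕ → Set α) (f : ℕ → ℕ → ℕ) : Prop :=
  IsFast f ∧ IsFinitarySeq H ∧
    ∀ k l, 2 ^ phi H l * (f k l + phi H l + 2) < f (k + 1) l

/-- A weak creature for `H`: a triple `(nor, val, dis)`.  The type `D` holds the
distinguishing parameters `dis`. -/
@[ext] structure WeakCreature (H : ℕ → Set α) (D : Type v) where
  nor : ℝ
  val : Set (List α × List α)
  dis : D
  nor_nonneg : 0 ≤ nor
  val_nonempty : val.Nonempty
  val_spec : ∀ x ∈ val, IsSeq H x.1 ∧ IsSeq H x.2 ∧ x.1 <+: x.2 ∧ x.1.length < x.2.length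

end Sequences

section Creature

variable {α : Type u} {H : ℕ → Set α} {D : Type v}

/-- `m_dn(t)`, the least length of an element of `dom(val[t])`. -/
noncomputable def WeakCreature.mdn (t : WeakCreature H D) : ℕ :=
  sInf ((fun x : List α × List α => x.1.length) '' t.val)

/-- `m_up(t)`, the least length of an element of `rng(val[t])`. -/
noncomputable def WeakCreature.mup (t : WeakCreature H D) : ℕ :=
  sInf ((fun x : List α × List α => x.2.length) '' t.val)

/-- `t` is a creature: all elements of `dom(val[t])` have the same length `m_dn`, and all
elements of `rng(val[t])` have the same length `m_up`. -/
def WeakCreature.IsCreature (t : WeakCreature H D) : Prop :=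
  ∀ x ∈ t.val, x.1.length = t.mdn ∧ x.2.length = t.mup

theorem WeakCreature.IsCreature.mdn_lt_mup {t : WeakCreature H D} (h : t.IsCreature) :
    t.mdn < t.mup := by
  obtain ⟨x, hx⟩ := t.val_nonempty
  have h1 := h x hx
  have h2 := (t.val_spec x hx).2.2.2
  omega

/-- The basis of `t` with respect to the operation `Sg`. -/
def basis (Sg : Set (WeakCreature H D) → Set (WeakCreature H D)) (t : WeakCreature H D) :
    Set (List α) :=
  {x | ∃ s ∈ Sg {t}, ∃ u, (x, u) ∈ s.val}

/-- `pos*(x, S)` with respect to the operation `Sg`. -/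
def posStar (Sg : Set (WeakCreature H D) → Set (WeakCreature H D)) (x : List α)
    (S : Set (WeakCreature H D)) : Set (List α) :=
  {u | ∃ s ∈ Sg S, (x, u) ∈ s.val}

/-- `IsPos Sg x S u` says that `S` is the union of finitely many pairwise disjoint sets
`S_0, …, S_{m-1}` for which there are `x = u_0, u_1, …, u_m = u` with
`u_{i+1} ∈ pos*(u_i, S_i)` for `i < m`.  (Each `u_i` is then an initial segment of `u`, and
the lengths of the `u_i` are strictly increasing.)  For `m = 0` this reads
`S = ∅` and `u = x`. -/
inductive IsPos (Sg : Set (WeakCreature H D) → Set (WeakCreature H D)) :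
    List α → Set (WeakCreature H D) → List α → Prop
  | nil (x : List α) : IsPos Sg x ∅ x
  | cons {x y u : List α} {A S : Set (WeakCreature H D)} :
      y ∈ posStar Sg x A → Disjoint A S → IsPos Sg y S u → IsPos Sg x (A ∪ S) u

/-- `pos(x, S)`, the set of possible extensions of `x` from the point of view of `S`. -/
def pos (Sg : Set (WeakCreature H D) → Set (WeakCreature H D)) (x : List α)
    (S : Set (WeakCreature H D)) : Set (List α) :=
  {u | IsPos Sg x S u}

/-- The set `{t_m, …, t_{n-1}}`. -/
def seg (t : ℕ → WeakCreature H D) (m n : ℕ) : Set (WeakCreature H D) :=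
  t '' Set.Ico m n

/-- `t_0, …, t_{n-1}` are elements of `K`, and `m_up(t_i) = m_dn(t_{i+1})` for `i + 1 < n`. -/
def IsLinked (K : Set (WeakCreature H D)) (t : ℕ → WeakCreature H D) (n : ℕ) : Prop :=
  (∀ i < n, t i ∈ K) ∧ ∀ i, i + 1 < n → (t i).mup = (t (i + 1)).mdn

/-- `(x, t_0, …, t_{n-1})` is a finite candidate (where `n ≥ 1`). -/
def IsFC (K : Set (WeakCreature H D)) (Sg : Set (WeakCreature H D) → Set (WeakCreature H D))
    (x : List α) (t : ℕ → WeakCreature H D) (n : ℕ) : Prop :=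
  1 ≤ n ∧ IsLinked K t n ∧ x ∈ basis Sg (t 0) ∧
    ∀ i, i + 1 < n → pos Sg x (seg t 0 (i + 1)) ⊆ basis Sg (t (i + 1))

/-- `(t_0, …, t_{n-1})` is a pure finite candidate (where `n ≥ 1`). -/
def IsPFC (K : Set (WeakCreature H D)) (Sg : Set (WeakCreature H D) → Set (WeakCreature H D))
    (t : ℕ → WeakCreature H D) (n : ℕ) : Prop :=
  ∃ x ∈ basis Sg (t 0), IsFC K Sg x t n

end Creature

/-- A creating pair `(K, Σ)` for `H`, which is nice and smooth.  The operation `Sg` stands for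
`Σ`; only its values at countable subsets of `K` are relevant. -/
structure CreatingPair {α : Type u} (H : ℕ → Set α) (D : Type v) where
  /-- the family of creatures -/
  K : Set (WeakCreature H D)
  /-- the composition operation -/
  Sg : Set (WeakCreature H D) → Set (WeakCreature H D)
  creature : ∀ t ∈ K, t.IsCreature
  Sg_subset : ∀ S ⊆ K, S.Countable → Sg S ⊆ K
  /-- transitivity -/
  Sg_trans : ∀ S ⊆ K, S.Countable → ∀ T : WeakCreature H D → Set (WeakCreature H D),
    (∀ s ∈ S, T s ⊆ K ∧ (T s).Countable ∧ s ∈ Sg (T s)) → Sg S ⊆ Sg (⋃ s ∈ S, T s)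
  Sg_self : ∀ r ∈ K, r ∈ Sg {r}
  Sg_empty : Sg ∅ = ∅
  /-- `Σ(S)` can be non-empty only for finite `S` which can be enumerated as a linked
  sequence -/
  Sg_linked : ∀ S ⊆ K, S.Countable → (Sg S).Nonempty →
    ∃ (n : ℕ) (t : ℕ → WeakCreature H D), S = seg t 0 n ∧ IsLinked K t n
  Sg_ends : ∀ (n : ℕ) (t : ℕ → WeakCreature H D), IsLinked K t (n + 1) →
    ∀ s ∈ Sg (seg t 0 (n + 1)), s.mdn = (t 0).mdn ∧ s.mup = (t n).mup
  nice : ∀ (n : ℕ) (t : ℕ → WeakCreature H D), IsLinked K t (n + 1) →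
    ∀ s ∈ Sg (seg t 0 (n + 1)), basis Sg (t 0) ⊆ basis Sg s
  smooth : ∀ (x : List α) (n : ℕ) (t : ℕ → WeakCreature H D), IsFC K Sg x t n →
    ∀ m < n, ∀ u ∈ pos Sg x (seg t 0 n),
      u.take (t m).mdn ∈ pos Sg x (seg t 0 m) ∧
        u ∈ pos Sg (u.take (t m).mdn) (seg t m n)

section Properties

variable {α : Type u} {H : ℕ → Set α} {D : Type v} (P : CreatingPair H D)

/-- `(K, Σ)` is finitary. -/
def CreatingPair.IsFinitary : Prop :=
  IsFinitarySeq H ∧ ∀ t ∈ P.K, t.val.Finite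

/-- `K` is full. -/
def CreatingPair.IsFull : Prop :=
  ∀ t ∈ P.K, {x : List α | ∃ u, (x, u) ∈ t.val} = {x | IsSeq H x ∧ x.length = t.mdn}

/-- `(K, Σ)` is simple. -/
def CreatingPair.IsSimple : Prop :=
  ∀ S ⊆ P.K, S.Countable → (P.Sg S).Nonempty → ∃ t, S = {t}

/-- `(K, Σ)` is gluing.  The last line says that
`nor[s] ≥ min {k, nor[t_0], …, nor[t_n]}`. -/
def CreatingPair.IsGluing : Prop :=
  P.IsFull ∧ ∀ k : ℕ, ∃ n₀ : ℕ, ∀ n ≥ n₀, ∀ t : ℕ → WeakCreature H D,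
    IsPFC P.K P.Sg t (n + 1) → ∃ s ∈ P.Sg (seg t 0 (n + 1)),
      (k : ℝ) ≤ s.nor ∨ ∃ i ≤ n, (t i).nor ≤ s.nor

/-- `(K, Σ)` is `r`-big, for a sequence `r` of integers. -/
def CreatingPair.IsBig (r : ℕ → ℕ) : Prop :=
  ∀ t ∈ P.K, 1 < t.nor → ∀ u ∈ basis P.Sg t, ∀ c : pos P.Sg u {t} → Fin (r t.mdn),
    ∃ s ∈ P.Sg {t}, t.nor - 1 ≤ s.nor ∧
      ∃ a, ∀ x : pos P.Sg u {t}, (x : List α) ∈ pos P.Sg u {s} → c x = a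

/-- `(K, Σ)` has the Halving Property.  The condition `∃ i ≤ n, (t i).nor / 2 ≤ s.nor` says that
`nor[s] ≥ min {nor[t_i] / 2 : i ≤ n}`. -/
def CreatingPair.HasHalving : Prop :=
  ∃ half : WeakCreature H D → WeakCreature H D,
    (∀ t ∈ P.K, half t ∈ P.Sg {t} ∧ t.nor / 2 ≤ (half t).nor) ∧
    ∀ (n : ℕ) (t : ℕ → WeakCreature H D), IsLinked P.K t (n + 1) → (∀ i ≤ n, 2 ≤ (t i).nor) →
      ∀ t' ∈ P.Sg (seg (fun i => half (t i)) 0 (n + 1)), 0 < t'.nor →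
        ∃ s ∈ P.Sg (seg t 0 (n + 1)), (∃ i ≤ n, (t i).nor / 2 ≤ s.nor) ∧
          ∀ u ∈ basis P.Sg (t 0), pos P.Sg u {s} ⊆ pos P.Sg u {t'}

end Properties

section Forcing

variable {α : Type u} {H : ℕ → Set α} {D : Type v}

/-- The conditions `(stem, t_0, t_1, …)` of the forcing notion `Q*_C(K, Σ)` determined by a
property `C` of sequences of creatures. -/
@[ext] structure QStar (P : CreatingPair H D) (C : (ℕ → WeakCreature H D) → Prop) where
  stem : List α
  t : ℕ → WeakCreature H D
  t_mem : ∀ i, t i ∈ P.K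
  stem_mem : stem ∈ basis P.Sg (t 0)
  pos_mem : ∀ (I : Set ℕ), ∀ u ∈ pos P.Sg stem (t '' I), ∃ i, i ∉ I ∧ u ∈ basis P.Sg (t i)
  link : ∀ i, (t i).mup = (t (i + 1)).mdn
  norm_cond : C t

/-- The order of `Q*_C(K, Σ)`; the larger condition is the stronger one. -/
def QStar.IsLE {P : CreatingPair H D} {C : (ℕ → WeakCreature H D) → Prop}
    (p q : QStar P C) : Prop :=
  ∃ (S₀ : Set ℕ) (S : ℕ → Set ℕ),
    (∀ i, Disjoint S₀ (S i)) ∧ (∀ i j, i ≠ j → Disjoint (S i) (S j)) ∧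
    q.stem ∈ pos P.Sg p.stem (p.t '' S₀) ∧ ∀ i, q.t i ∈ P.Sg (p.t '' S i)

theorem QStar.mdn_lt_mdn {P : CreatingPair H D} {C : (ℕ → WeakCreature H D) → Prop}
    (p : QStar P C) : StrictMono fun i => (p.t i).mdn := by
  refine strictMono_nat_of_lt_succ fun i => ?_
  rw [← p.link i]
  exact (P.creature _ (p.t_mem i)).mdn_lt_mup

theorem QStar.t_injective {P : CreatingPair H D} {C : (ℕ → WeakCreature H D) → Prop}
    (p : QStar P C) : Function.Injective p.t := fun i j hij =>
  p.mdn_lt_mdn.injective (by simp only [hij])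

theorem IsPos.trans {Sg : Set (WeakCreature H D) → Set (WeakCreature H D)} {x y z : List α}
    {S T : Set (WeakCreature H D)} (h : IsPos Sg x S y) (h' : IsPos Sg y T z)
    (hd : Disjoint S T) : IsPos Sg x (S ∪ T) z := by
  induction h with
  | nil x => simpa using h'
  | @cons x y u A S hy hAS _ ih =>
    rw [Set.disjoint_union_left] at hd
    rw [Set.union_assoc]
    exact IsPos.cons hy (Set.disjoint_union_right.2 ⟨hAS, hd.1⟩) (ih h' hd.2)

theorem IsPos.coarsen (P : CreatingPair H D) {x u : List α} {S : Set (WeakCreature H D)}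
    (h : IsPos P.Sg x S u) (T : WeakCreature H D → Set (WeakCreature H D))
    (hS : S ⊆ P.K) (hc : S.Countable)
    (hT : ∀ s ∈ S, T s ⊆ P.K ∧ (T s).Countable ∧ s ∈ P.Sg (T s))
    (hd : ∀ s ∈ S, ∀ s' ∈ S, s ≠ s' → Disjoint (T s) (T s')) :
    IsPos P.Sg x (⋃ s ∈ S, T s) u := by
  induction h with
  | nil x => simpa using IsPos.nil x
  | @cons x y u A S hy hAS _ ih =>
    rw [Set.biUnion_union]
    obtain ⟨s, hs, hxy⟩ := hy
    refine IsPos.cons ⟨s, ?_, hxy⟩ ?_ (ih (fun a ha => hS (Or.inr ha))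
      (hc.mono Set.subset_union_right) (fun a ha => hT a (Or.inr ha))
      (fun a ha b hb => hd a (Or.inr ha) b (Or.inr hb)))
    · exact P.Sg_trans A (fun a ha => hS (Or.inl ha)) (hc.mono Set.subset_union_left) T
        (fun a ha => hT a (Or.inl ha)) hs
    · simp only [Set.disjoint_iUnion_left, Set.disjoint_iUnion_right]
      intro a ha b hb
      refine hd _ (by tauto) _ (by tauto) ?_
      rintro rfl
      exact Set.disjoint_left.1 hAS (by assumption) (by assumption)

theorem QStar.IsLE.refl {P : CreatingPair H D} {C : (ℕ → WeakCreature H D) → Prop}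
    (p : QStar P C) : p.IsLE p := by
  refine ⟨∅, fun i => {i}, by simp, by simp, ?_, fun i => ?_⟩
  · rw [Set.image_empty]
    exact IsPos.nil p.stem
  · simpa using P.Sg_self _ (p.t_mem i)

theorem QStar.IsLE.trans {P : CreatingPair H D} {C : (ℕ → WeakCreature H D) → Prop}
    {p q r : QStar P C} (hpq : p.IsLE q) (hqr : q.IsLE r) : p.IsLE r := by
  obtain ⟨S₀, S, hS₀, hS, hst, ht⟩ := hpq
  obtain ⟨R₀, R, hR₀, hR, hst', ht'⟩ := hqr
  have hp : ∀ A : Set ℕ, p.t '' A ⊆ P.K := by rintro A _ ⟨i, _, rfl⟩; exact p.t_mem i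
  have hq : ∀ A : Set ℕ, q.t '' A ⊆ P.K := by rintro A _ ⟨i, _, rfl⟩; exact q.t_mem i
  have hcp : ∀ A : Set ℕ, (p.t '' A).Countable := fun A => A.to_countable.image _
  have hcq : ∀ A : Set ℕ, (q.t '' A).Countable := fun A => A.to_countable.image _
  have hdis : ∀ A B : Set ℕ, Disjoint A B → Disjoint (p.t '' A) (p.t '' B) := fun A B h =>
    (Set.disjoint_image_iff p.t_injective).2 h
  set T : WeakCreature H D → Set (WeakCreature H D) :=
    fun s => p.t '' S (Function.invFun q.t s) with hT
  have hTq : ∀ i, T (q.t i) = p.t '' S i := fun i => by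
    simp only [hT, Function.leftInverse_invFun q.t_injective i]
  have hU : ∀ A : Set ℕ, (⋃ s ∈ q.t '' A, T s) = p.t '' ⋃ i ∈ A, S i := fun A => by
    rw [Set.biUnion_image, Set.image_iUnion₂]
    exact Set.iUnion₂_congr fun i _ => hTq i
  have hTs : ∀ A : Set ℕ, ∀ s ∈ q.t '' A, T s ⊆ P.K ∧ (T s).Countable ∧ s ∈ P.Sg (T s) := by
    rintro A _ ⟨i, _, rfl⟩
    rw [hTq]
    exact ⟨hp _, hcp _, ht i⟩
  refine ⟨S₀ ∪ ⋃ i ∈ R₀, S i, fun n => ⋃ i ∈ R n, S i, fun n => ?_, fun m n hmn => ?_, ?_,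
    fun n => ?_⟩
  · rw [Set.disjoint_union_left]
    simp only [Set.disjoint_iUnion_left, Set.disjoint_iUnion_right]
    refine ⟨fun i _ => hS₀ i, fun i hi j hj => hS _ _ ?_⟩
    rintro rfl
    exact Set.disjoint_left.1 (hR₀ n) (by assumption) (by assumption)
  · simp only [Set.disjoint_iUnion_left, Set.disjoint_iUnion_right]
    intro i hi j hj
    refine hS _ _ ?_
    rintro rfl
    exact Set.disjoint_left.1 (hR m n hmn) (by assumption) (by assumption)
  · rw [Set.image_union, ← hU R₀]
    refine IsPos.trans hst (IsPos.coarsen P hst' T (hq _) (hcq _) (hTs _) ?_) ?_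
    · rintro _ ⟨i, _, rfl⟩ _ ⟨j, _, rfl⟩ hij
      rw [hTq, hTq]
      exact hdis _ _ (hS _ _ fun h => hij (by rw [h]))
    · rw [hU]
      refine hdis _ _ ?_
      simp only [Set.disjoint_iUnion_right]
      exact fun i _ => hS₀ i
  · rw [← hU]
    exact P.Sg_trans _ (hq _) (hcq _) T (hTs _) (ht' n)

instance {P : CreatingPair H D} {C : (ℕ → WeakCreature H D) → Prop} :
    Preorder (QStar P C) where
  le := QStar.IsLE
  le_refl := QStar.IsLE.refl
  le_trans _ _ _ := QStar.IsLE.trans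

/-- The norm condition `C^f(nor)`. -/
def NormCond (H : ℕ → Set α) (D : Type v) (f : ℕ → ℕ → ℕ) (t : ℕ → WeakCreature H D) : Prop :=
  ∀ k : ℕ, ∀ᶠ i in Filter.atTop, (f k (t i).mdn : ℝ) < (t i).nor

/-- The forcing notion `Q*_f(K, Σ)`. -/
abbrev QF (P : CreatingPair H D) (f : ℕ → ℕ → ℕ) : Type (max u v) :=
  QStar P (NormCond H D f)

/-- The relation `p ≤^f_n q` on `Q*_f(K, Σ)`.  (The set of which the least element is taken is
non-empty by the norm condition.) -/
def QF.LEn {P : CreatingPair H D} {f : ℕ → ℕ → ℕ} : ℕ → QF P f → QF P f → Prop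
  | 0, p, q => p ≤ q ∧ p.stem = q.stem
  | n + 1, p, q => (p ≤ q ∧ p.stem = q.stem) ∧
      (∀ j ≤ sInf {i : ℕ | (f (n + 1) (p.t i).mdn : ℝ) < (p.t i).nor}, p.t j = q.t j) ∧
      ∀ i, (q.t i).nor ≤ (f (n + 1) (q.t i).mdn : ℝ) → q.t i ∈ Set.range p.t

end Forcing

section Names

/-- A name for an ordinal, with respect to a forcing notion `Q` in which larger conditions are
stronger.  It is given by a set of pairs `(a, o)`; in the extension by a generic filter `G` it
denotes the ordinal `o` for which there is some `(a, o)` in this set with `a ∈ G`.  The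
two conditions say that it is forced that there is exactly one such `o`. -/
structure OrdName (Q : Type u) [Preorder Q] where
  pairs : Set (Q × Ordinal.{w})
  exists_value : ∀ p : Q, ∃ r, p ≤ r ∧ ∃ x ∈ pairs, x.1 ≤ r
  value_unique : ∀ x ∈ pairs, ∀ y ∈ pairs, (∃ r, x.1 ≤ r ∧ y.1 ≤ r) → x.2 = y.2

variable {Q : Type u} [Preorder Q]

/-- `p` forces that the value of the name is `o`: densely many conditions above `p` are above some
`a` with `(a, o)` in the name. -/
def OrdName.Forces (τ : OrdName.{u, w} Q) (p : Q) (o : Ordinal.{w}) : Prop :=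
  ∀ q, p ≤ q → ∃ r, q ≤ r ∧ ∃ a ≤ r, (a, o) ∈ τ.pairs

/-- `p` decides the value of the name. -/
def OrdName.DecidedBy (τ : OrdName.{u, w} Q) (p : Q) : Prop :=
  ∃ o, τ.Forces p o

/-- `C` is a club of countable subsets of `X`. -/
def IsCountableClub {X : Type u} (C : Set (Set X)) : Prop :=
  (∀ A ∈ C, A.Countable) ∧ (∀ A : Set X, A.Countable → ∃ B ∈ C, A ⊆ B) ∧
    ∀ A : ℕ → Set X, Monotone A → (∀ n, A n ∈ C) → (⋃ n, A n) ∈ C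

/-- `D` is dense in `Q`. -/
def IsDenseSet (D : Set Q) : Prop :=
  ∀ p, ∃ d ∈ D, p ≤ d

/-- For a set `N` of conditions and of sets of conditions, `q` is `(N, Q)`-generic:
for each dense `D ∈ N`, the set `D ∩ N` is predense above `q`. -/
def IsGenericFor (N : Set (Q ⊕ Set Q)) (q : Q) : Prop :=
  ∀ D : Set Q, Sum.inr D ∈ N → IsDenseSet D →
    ∀ r, q ≤ r → ∃ d ∈ D, Sum.inl d ∈ N ∧ ∃ s, r ≤ s ∧ d ≤ s

/-- `Q` is proper: for club many countable `N ⊆ Q ∪ 𝒫(Q)`, each condition in `N` has an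
`(N, Q)`-generic extension. -/
def IsProperForcing (Q : Type u) [Preorder Q] : Prop :=
  ∃ C : Set (Set (Q ⊕ Set Q)), IsCountableClub C ∧
    ∀ N ∈ C, ∀ p : Q, Sum.inl p ∈ N → ∃ q, p ≤ q ∧ IsGenericFor N q

end Names

section Deciding

variable {α : Type u} {H : ℕ → Set α} {D : Type v}

/-- `p` essentially decides `τ`: for some `m`, for all `x ∈ pos(w^p, t^p_0, …, t^p_{m-1})`, the
condition `(x, t^p_m, t^p_{m+1}, …)` decides the value of `τ`. -/
def QStar.EssentiallyDecides {P : CreatingPair H D} {C : (ℕ → WeakCreature H D) → Prop}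
    (p : QStar P C) (τ : OrdName.{max u v, w} (QStar P C)) : Prop :=
  ∃ m, ∀ x ∈ pos P.Sg p.stem (seg p.t 0 m),
    ∃ r : QStar P C, r.stem = x ∧ (∀ i, r.t i = p.t (m + i)) ∧ τ.DecidedBy r

end Deciding

end Creatures

/-! Everything reduces to one statement: for a dense, upward closed set `E` of conditions, each `p`
and each `k`, some `q` with `p ≤^f_{k+1} q` is essentially in `E`, meaning that at some level all
its tails lie in `E` (`exists_lEn_enters`). Fusion does the rest, since ω such steps with growing
index have a limit (`QF.exists_lEn_limit`). Applied to the sets of conditions deciding the given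
names, this yields the first claim. Applied to the dense sets in a suitable countable `N`, it yields
a generic condition.

To prove the statement, say that a stem avoids `E` along `t` if no refinement with that stem and
merely positive norms is essentially in `E`. The Halving Property gives a dichotomy. Pass to the
halves of the creatures. If they do not avoid `E`, a refinement with positive norms enters `E`;
un-halving finitely many of its creatures restores their norms up to a factor 2 and adds no
possibilities. The dichotomy is then arranged at every level and for every possibility there. Level
`i` costs at most `φ(m_dn(t_i))` halvings. Since `φ` doubles, all levels up to `i` cost at most
twice that, which two steps in the first argument of `f` absorb (`exists_dichotomy`).

Suppose that a stem avoids `E` after this. Bigness shrinks each creature so that, above any given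
possibility, either all or none of the next possibilities enter `E`. If all did, avoidance one level
below would fail; so avoidance spreads to all possibilities. But density provides an extension in
`E`, and a tail of it with positive norms contradicts avoidance (`exists_enters`). -/

namespace Creatures

/-! ### Counting finite sequences -/

section Sequences

variable {α : Type u} {H : ℕ → Set α}

/-- The product `∏_{i < l} H(i)`. -/
def seqs (H : ℕ → Set α) (l : ℕ) : Set (List α) :=
  {w | IsSeq H w ∧ w.length = l}

theorem append_singleton_mem_seqs {l : ℕ} {w : List α} {a : α} :
    w ++ [a] ∈ seqs H (l + 1) ↔ w ∈ seqs H l ∧ a ∈ H l := by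
  simp only [seqs, IsSeq, Set.mem_ofPred_eq, List.length_append, List.length_singleton,
    Nat.add_right_cancel_iff]
  constructor
  · rintro ⟨h, rfl⟩
    refine ⟨⟨fun i hi => ?_, rfl⟩, ?_⟩
    · have := h i (by omega)
      rwa [List.getElem_append_left hi] at this
    · have := h w.length (by omega)
      simpa using this
  · rintro ⟨⟨h, rfl⟩, ha⟩
    refine ⟨fun i hi => ?_, rfl⟩
    rcases Nat.lt_succ_iff_lt_or_eq.1 hi with hi' | rfl
    · rw [List.getElem_append_left hi']
      exact h i hi'
    · simpa using ha

theorem seqs_finite (h : IsFinitarySeq H) (l : ℕ) : (seqs H l).Finite := by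
  induction l with
  | zero =>
    refine (Set.finite_singleton ([] : List α)).subset ?_
    rintro w ⟨_, hw⟩
    simpa using hw
  | succ l ih =>
    refine (Set.Finite.image2 (fun (w : List α) (a : α) => w ++ [a]) ih (h l)).subset ?_
    intro w hw
    have hne : w ≠ [] := by
      rintro rfl
      simpa using hw.2
    rw [← List.dropLast_append_getLast hne, append_singleton_mem_seqs] at hw
    exact ⟨_, hw.1, _, hw.2, List.dropLast_append_getLast hne⟩

/-- Two distinct values in `H l` extend the sequences of length `l` to two disjoint families. -/
theorem two_mul_phi_le (h : IsFinitarySeq H) (hH : ∀ m, (H m).Nontrivial) (l : ℕ) :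
    2 * phi H l ≤ phi H (l + 1) := by
  obtain ⟨a, ha, b, hb, hab⟩ := hH l
  have hinj : ∀ c : α, Function.Injective fun w : List α => w ++ [c] := fun c x y hxy => by
    simpa using hxy
  have hA := Set.ncard_image_of_injective (seqs H l) (hinj a)
  have hB := Set.ncard_image_of_injective (seqs H l) (hinj b)
  have hd : Disjoint ((fun w : List α => w ++ [a]) '' seqs H l)
      ((fun w : List α => w ++ [b]) '' seqs H l) := by
    rw [Set.disjoint_left]
    rintro _ ⟨x, _, rfl⟩ ⟨y, _, hy⟩
    have := congrArg List.getLast? hy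
    simp at this
    exact hab this.symm
  have hU := Set.ncard_union_eq hd ((seqs_finite h l).image _) ((seqs_finite h l).image _)
  have hsub : (fun w : List α => w ++ [a]) '' seqs H l ∪ (fun w : List α => w ++ [b]) '' seqs H l
      ⊆ seqs H (l + 1) := by
    rintro _ (⟨x, hx, rfl⟩ | ⟨x, hx, rfl⟩)
    exacts [append_singleton_mem_seqs.2 ⟨hx, ha⟩, append_singleton_mem_seqs.2 ⟨hx, hb⟩]
  have hle := Set.ncard_le_ncard hsub (seqs_finite h (l + 1))
  rw [hU, hA, hB] at hle
  change 2 * (seqs H l).ncard ≤ (seqs H (l + 1)).ncard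
  omega

theorem phi_mono (h : IsFinitarySeq H) (hH : ∀ m, (H m).Nontrivial) : Monotone (phi H) :=
  monotone_nat_of_le_succ fun l => by
    have := two_mul_phi_le h hH l
    omega

/-- Since `phi H` at least doubles from level to level, the last term dominates the sum. This bounds
the number of halvings in the fusion. -/
theorem sum_phi_le (h : IsFinitarySeq H) (hH : ∀ m, (H m).Nontrivial) {l : ℕ → ℕ}
    (hl : StrictMono l) (n : ℕ) :
    ∑ i ∈ Finset.range (n + 1), phi H (l i) ≤ 2 * phi H (l n) := by
  induction n with
  | zero => simp; omega
  | succ n ih =>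
    rw [Finset.sum_range_succ]
    have h1 := two_mul_phi_le h hH (l n)
    have h2 := phi_mono h hH (Nat.succ_le_of_lt (hl (Nat.lt_succ_self n)))
    simp only [Nat.succ_eq_add_one] at h2
    omega

end Sequences

/-! ### Segments and linked chains of creatures -/

section Segments

variable {α : Type u} {H : ℕ → Set α} {D : Type v} {t s : ℕ → WeakCreature H D}

theorem seg_self (t : ℕ → WeakCreature H D) (a : ℕ) : seg t a a = ∅ := by simp [seg]

theorem seg_succ (t : ℕ → WeakCreature H D) (a : ℕ) : seg t a (a + 1) = {t a} := by
  have : Set.Ico a (a + 1) = {a} := by ext; simp; omega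
  rw [seg, this, Set.image_singleton]

theorem seg_union (t : ℕ → WeakCreature H D) {a b c : ℕ} (hab : a ≤ b) (hbc : b ≤ c) :
    seg t a b ∪ seg t b c = seg t a c := by
  rw [seg, seg, seg, ← Set.image_union, Set.Ico_union_Ico_eq_Ico hab hbc]

/-- The sequence `t_m, t_{m+1}, …`. -/
def shift (t : ℕ → WeakCreature H D) (m : ℕ) : ℕ → WeakCreature H D := fun i => t (m + i)

@[simp] theorem shift_apply (t : ℕ → WeakCreature H D) (m i : ℕ) : shift t m i = t (m + i) := rfl

@[simp] theorem shift_zero (t : ℕ → WeakCreature H D) : shift t 0 = t := by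
  funext i; simp

theorem shift_shift (t : ℕ → WeakCreature H D) (m n : ℕ) :
    shift (shift t m) n = shift t (m + n) := by
  funext i; simp [add_assoc]

theorem seg_shift (t : ℕ → WeakCreature H D) (m a b : ℕ) :
    seg (shift t m) a b = seg t (m + a) (m + b) := by
  ext x
  simp only [seg, Set.mem_image, Set.mem_Ico, shift_apply]
  constructor
  · rintro ⟨i, hi, rfl⟩
    exact ⟨m + i, by omega, rfl⟩
  · rintro ⟨i, hi, rfl⟩
    exact ⟨i - m, by omega, by congr 1; omega⟩

theorem seg_congr {a b : ℕ} (h : ∀ i, a ≤ i → i < b → t i = s i) : seg t a b = seg s a b :=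
  Set.image_congr fun i hi => h i hi.1 hi.2

theorem seg_countable (t : ℕ → WeakCreature H D) (a b : ℕ) : (seg t a b).Countable :=
  (Set.to_countable _).image _

end Segments

section Chains

variable {α : Type u} {H : ℕ → Set α} {D : Type v} {P : CreatingPair H D}
  {t s r : ℕ → WeakCreature H D}

/-- An infinite sequence of creatures every initial segment of which is linked. -/
structure IsChain (P : CreatingPair H D) (t : ℕ → WeakCreature H D) : Prop where
  mem : ∀ i, t i ∈ P.K
  link : ∀ i, (t i).mup = (t (i + 1)).mdn

namespace IsChain

theorem strictMono (h : IsChain P t) : StrictMono fun i => (t i).mdn := by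
  refine strictMono_nat_of_lt_succ fun i => ?_
  rw [← h.link i]
  exact (P.creature _ (h.mem i)).mdn_lt_mup

theorem injective (h : IsChain P t) : Function.Injective t := fun i j hij =>
  h.strictMono.injective (by simp only [hij])

theorem mdn_inj (h : IsChain P t) {i j : ℕ} (hij : (t i).mdn = (t j).mdn) : i = j :=
  h.strictMono.injective hij

theorem shift (h : IsChain P t) (m : ℕ) : IsChain P (shift t m) :=
  ⟨fun _ => h.mem _, fun _ => h.link _⟩

theorem isLinked (h : IsChain P t) (n : ℕ) : IsLinked P.K t n :=
  ⟨fun i _ => h.mem i, fun i _ => h.link i⟩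

theorem seg_subset (h : IsChain P t) (a b : ℕ) : seg t a b ⊆ P.K := by
  rintro _ ⟨i, _, rfl⟩
  exact h.mem i

theorem disjoint_seg (h : IsChain P t) {a b c d : ℕ} (hbc : b ≤ c) :
    Disjoint (seg t a b) (seg t c d) := by
  refine (Set.disjoint_image_iff h.injective).2 (Set.disjoint_left.2 fun x hx hx' => ?_)
  have := hx.2
  have := hx'.1
  omega

theorem sg_mem (h : IsChain P t) {a b : ℕ} {x : WeakCreature H D} (hx : x ∈ P.Sg (seg t a b)) :
    x ∈ P.K :=
  P.Sg_subset _ (h.seg_subset a b) (seg_countable t a b) hx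

theorem sg_ends (h : IsChain P t) {a b : ℕ} (hab : a < b) {x : WeakCreature H D}
    (hx : x ∈ P.Sg (seg t a b)) : x.mdn = (t a).mdn ∧ x.mup = (t b).mdn := by
  obtain ⟨n, rfl⟩ := Nat.exists_eq_add_of_lt hab
  have hs := seg_shift t a 0 (n + 1)
  rw [add_zero, ← add_assoc] at hs
  rw [← hs] at hx
  have := P.Sg_ends n _ ((h.shift a).isLinked _) x hx
  simp only [shift_apply, add_zero] at this
  exact ⟨this.1, by rw [this.2, h.link]⟩

theorem sg_nice (h : IsChain P t) {a b : ℕ} (hab : a < b) {x : WeakCreature H D}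
    (hx : x ∈ P.Sg (seg t a b)) : basis P.Sg (t a) ⊆ basis P.Sg x := by
  obtain ⟨n, rfl⟩ := Nat.exists_eq_add_of_lt hab
  have hs := seg_shift t a 0 (n + 1)
  rw [add_zero, ← add_assoc] at hs
  rw [← hs] at hx
  simpa using P.nice n _ ((h.shift a).isLinked _) x hx

/-- A subset of a chain which `Σ` composes is an interval of the chain. -/
theorem eq_seg_of_sg_nonempty (h : IsChain P t) {A : Set (WeakCreature H D)}
    (hA : A ⊆ Set.range t) (hne : (P.Sg A).Nonempty) : ∃ a b, a < b ∧ A = seg t a b := by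
  obtain ⟨n, t', rfl, hl⟩ := P.Sg_linked A (hA.trans (by rintro _ ⟨i, rfl⟩; exact h.mem i))
    ((Set.countable_range t).mono hA) hne
  rcases Nat.eq_zero_or_pos n with rfl | hn
  · rw [seg_self, P.Sg_empty] at hne
    exact absurd hne Set.not_nonempty_empty
  obtain ⟨a, ha⟩ := hA ⟨0, ⟨le_rfl, hn⟩, rfl⟩
  -- In a chain `m_dn` determines the index, so each creature of the linked enumeration is the
  -- immediate successor in `t` of the one before.
  have key : ∀ i < n, t (a + i) = t' i := by
    intro i
    induction i with
    | zero => intro _; simpa using ha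
    | succ i ih =>
      intro hi
      obtain ⟨j, hj⟩ := hA ⟨i + 1, ⟨by omega, hi⟩, rfl⟩
      have h1 := hl.2 i hi
      rw [← hj, ← ih (by omega), h.link] at h1
      rw [← hj, ← h.mdn_inj h1]
      rfl
  refine ⟨a, a + n, by omega, ?_⟩
  have := seg_shift t a 0 n
  rw [add_zero] at this
  rw [← this]
  exact seg_congr fun i _ hi => (key i hi).symm

theorem basis_length {x : List α} {c : WeakCreature H D} (hc : c ∈ P.K)
    (hx : x ∈ basis P.Sg c) : IsSeq H x ∧ x.length = c.mdn := by
  obtain ⟨s, hs, u, hu⟩ := hx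
  have hl : IsLinked P.K (fun _ => c) 1 := ⟨fun _ _ => hc, fun i hi => by omega⟩
  have hs' : s ∈ P.Sg (seg (fun _ => c) 0 1) := by rwa [seg_succ]
  have hK : s ∈ P.K := P.Sg_subset {c} (by simpa using hc) (Set.countable_singleton c) hs
  exact ⟨(s.val_spec _ hu).1,
    ((P.creature s hK _ hu).1).trans (P.Sg_ends 0 _ hl s hs').1⟩

/-- Possibilities over a part of a chain use up an interval of the chain. -/
theorem isPos_eq_seg (h : IsChain P t) {x u : List α} {S : Set (WeakCreature H D)}
    (hp : IsPos P.Sg x S u) : ∀ a, S ⊆ Set.range t → x.length = (t a).mdn →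
      ∃ b, a ≤ b ∧ S = seg t a b ∧ u.length = (t b).mdn := by
  induction hp with
  | nil x => exact fun a _ hx => ⟨a, le_rfl, (seg_self t a).symm, hx⟩
  | @cons x y u A S hy _ _ ih =>
    intro a hS hx
    obtain ⟨s, hs, hxy⟩ := hy
    obtain ⟨c, d, hcd, rfl⟩ := h.eq_seg_of_sg_nonempty (Set.subset_union_left.trans hS) ⟨s, hs⟩
    have he := h.sg_ends hcd hs
    have hv := P.creature s (h.sg_mem hs) _ hxy
    obtain rfl : a = c := h.mdn_inj (hx.symm.trans (hv.1.trans he.1))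
    obtain ⟨b, hb, rfl, hu⟩ := ih d (Set.subset_union_right.trans hS) (hv.2.trans he.2)
    exact ⟨b, by omega, seg_union t (by omega) hb, hu⟩

theorem pos_length (h : IsChain P t) {x u : List α} {a b : ℕ} (hab : a ≤ b)
    (hx : x.length = (t a).mdn) (hu : u ∈ pos P.Sg x (seg t a b)) :
    u.length = (t b).mdn := by
  obtain ⟨c, hc, hS, hl⟩ := h.isPos_eq_seg hu a (Set.image_subset_range _ _) hx
  have : Set.Ico a b = Set.Ico a c := h.injective.image_injective hS
  rcases hab.eq_or_lt with rfl | hab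
  · rw [Set.Ico_self, eq_comm, Set.Ico_eq_empty_iff] at this
    rw [hl, show c = a by omega]
  · rw [hl, show c = b from ?_]
    have h1 : b - 1 ∈ Set.Ico a c := this ▸ ⟨by omega, by omega⟩
    have h2 : c - 1 ∈ Set.Ico a b := this ▸ ⟨by have := h1.1; have := h1.2; omega, by
      have := h1.1; have := h1.2; omega⟩
    have := h1.2
    have := h2.2
    omega

theorem pos_trans (h : IsChain P t) {x y u : List α} {a b c : ℕ} (hab : a ≤ b) (hbc : b ≤ c)
    (hy : y ∈ pos P.Sg x (seg t a b)) (hu : u ∈ pos P.Sg y (seg t b c)) :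
    u ∈ pos P.Sg x (seg t a c) := by
  rw [← seg_union t hab hbc]
  exact IsPos.trans hy hu (h.disjoint_seg le_rfl)

end IsChain

theorem isPos_isSeq {x u : List α} {S : Set (WeakCreature H D)}
    {Sg : Set (WeakCreature H D) → Set (WeakCreature H D)} (hp : IsPos Sg x S u) :
    IsSeq H x → IsSeq H u := by
  induction hp with
  | nil => exact id
  | cons hy _ _ ih =>
    obtain ⟨s, _, hxy⟩ := hy
    exact fun _ => ih (s.val_spec _ hxy).2.1

theorem pos_empty (x : List α) : pos P.Sg x ∅ = {x} := by
  refine Set.eq_singleton_iff_unique_mem.2 ⟨IsPos.nil x, fun u h => ?_⟩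
  change IsPos P.Sg x ∅ u at h
  generalize hE : (∅ : Set (WeakCreature H D)) = S at h
  cases h with
  | nil => rfl
  | @cons _ z _ A' S' hz _ _ =>
    obtain rfl : A' = ∅ := Set.subset_empty_iff.1 (Set.subset_union_left.trans hE.ge)
    obtain ⟨s, hs, _⟩ := hz
    rw [P.Sg_empty] at hs
    exact absurd hs (Set.notMem_empty s)

/-- Because `Σ(∅) = ∅`, a decomposition has no empty block, and a singleton has room for one block
only. -/
theorem mem_pos_singleton {x u : List α} {c : WeakCreature H D} :
    u ∈ pos P.Sg x {c} ↔ u ∈ posStar P.Sg x {c} := by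
  constructor
  · intro h
    have key : ∀ S, IsPos P.Sg x S u → S = {c} → u ∈ posStar P.Sg x {c} := by
      intro S h
      induction h with
      | nil => exact fun h => absurd h.symm (Set.singleton_ne_empty c)
      | @cons x y u A S hy hd h _ =>
        intro hS
        have hA : A = {c} := by
          rcases Set.subset_singleton_iff_eq.1 (Set.subset_union_left.trans hS.le) with rfl | h
          · obtain ⟨s, hs, _⟩ := hy
            rw [P.Sg_empty] at hs
            exact absurd hs (Set.notMem_empty s)
          · exact h
        subst hA
        have hS' : S = ∅ := by
          rcases Set.subset_singleton_iff_eq.1 (Set.subset_union_right.trans hS.le) with h | rfl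
          · exact h
          · exact absurd hd (by simp)
        subst hS'
        have huy : u ∈ pos P.Sg y ∅ := h
        rw [pos_empty, Set.mem_singleton_iff] at huy
        exact huy ▸ hy
    exact key _ h rfl
  · intro h
    have := IsPos.cons h (Set.disjoint_empty _) (IsPos.nil u)
    rwa [Set.union_empty] at this

theorem pos_singleton_nonempty {x : List α} {c : WeakCreature H D} (h : x ∈ basis P.Sg c) :
    (pos P.Sg x {c}).Nonempty := by
  obtain ⟨s, hs, u, hu⟩ := h
  exact ⟨u, mem_pos_singleton.2 ⟨s, hs, hu⟩⟩

end Chains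

/-! ### Refinements composed from consecutive intervals -/

section Refinements

variable {α : Type u} {H : ℕ → Set α} {D : Type v} {P : CreatingPair H D}
  {t s r : ℕ → WeakCreature H D}

/-- `b` lists the cuts of a decomposition of a final segment of `t` into intervals from which the
creatures `s_0, s_1, …` are composed. -/
structure Cuts (P : CreatingPair H D) (t s : ℕ → WeakCreature H D) (b : ℕ → ℕ) : Prop where
  strictMono : StrictMono b
  mem : ∀ i, s i ∈ P.Sg (seg t (b i) (b (i + 1)))

/-- `s` is a sequence of creatures composed from consecutive intervals of `t`. -/
structure Ref (P : CreatingPair H D) (t s : ℕ → WeakCreature H D) : Prop where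
  chain : IsChain P s
  mdn_zero : (s 0).mdn = (t 0).mdn
  local_mem : ∀ i, ∃ a b, a < b ∧ s i ∈ P.Sg (seg t a b)

/-- Neighbouring intervals abut, because the end level of `s i` is the start level of `s (i + 1)`
and levels determine indices in `t`. -/
theorem IsChain.exists_cuts (ht : IsChain P t) (hs : IsChain P s)
    (h : ∀ i, ∃ a b, a < b ∧ s i ∈ P.Sg (seg t a b)) : ∃ b, Cuts P t s b := by
  choose a b hab hm using h
  have key : ∀ i, b i = a (i + 1) := fun i => ht.mdn_inj <| by
    rw [← (ht.sg_ends (hab i) (hm i)).2, hs.link, (ht.sg_ends (hab (i + 1)) (hm (i + 1))).1]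
  exact ⟨a, strictMono_nat_of_lt_succ fun i => key i ▸ hab i, fun i => key i ▸ hm i⟩

namespace Cuts

variable {b : ℕ → ℕ}

theorem mdn_eq (h : Cuts P t s b) (ht : IsChain P t) (i : ℕ) : (s i).mdn = (t (b i)).mdn :=
  (ht.sg_ends (h.strictMono (Nat.lt_succ_self i)) (h.mem i)).1

theorem chain (h : Cuts P t s b) (ht : IsChain P t) : IsChain P s :=
  ⟨fun i => ht.sg_mem (h.mem i), fun i => by
    rw [(ht.sg_ends (h.strictMono (Nat.lt_succ_self i)) (h.mem i)).2, h.mdn_eq ht]⟩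

theorem ref (h : Cuts P t s b) (ht : IsChain P t) (h0 : b 0 = 0) : Ref P t s :=
  ⟨h.chain ht, by rw [h.mdn_eq ht, h0], fun i => ⟨_, _, h.strictMono (Nat.lt_succ_self i), h.mem i⟩⟩

/-- Transitivity of `Σ` indexes the covering sets by creatures, not by positions. As a chain is
injective, the position can be recovered from the creature. -/
theorem exists_cover (h : Cuts P t s b) (ht : IsChain P t) :
    ∃ T : WeakCreature H D → Set (WeakCreature H D),
      (∀ i, T (s i) = seg t (b i) (b (i + 1))) ∧
      (∀ i j, i ≤ j → (⋃ x ∈ seg s i j, T x) = seg t (b i) (b j)) := by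
  have hT : ∀ i, seg t (b (Function.invFun s (s i))) (b (Function.invFun s (s i) + 1)) =
      seg t (b i) (b (i + 1)) := fun i => by
    rw [Function.leftInverse_invFun (h.chain ht).injective i]
  refine ⟨fun x => seg t (b (Function.invFun s x)) (b (Function.invFun s x + 1)), hT, ?_⟩
  intro i j hij
  induction j, hij using Nat.le_induction with
  | base => simp [seg_self]
  | succ j hij ih =>
    rw [← seg_union s hij (Nat.le_succ j), Set.biUnion_union, ih, seg_succ, Set.biUnion_singleton,
      hT, seg_union t (h.strictMono.monotone hij) (h.strictMono.monotone (Nat.le_succ j))]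

theorem pos_subset (h : Cuts P t s b) (ht : IsChain P t) {x : List α} {i j : ℕ} (hij : i ≤ j) :
    pos P.Sg x (seg s i j) ⊆ pos P.Sg x (seg t (b i) (b j)) := by
  obtain ⟨T, hT, hU⟩ := h.exists_cover ht
  intro u hu
  rw [← hU i j hij]
  refine IsPos.coarsen P hu T ((h.chain ht).seg_subset _ _) (seg_countable _ _ _) ?_ ?_
  · rintro _ ⟨k, _, rfl⟩
    rw [hT]
    exact ⟨ht.seg_subset _ _, seg_countable _ _ _, h.mem k⟩
  · rintro _ ⟨k, _, rfl⟩ _ ⟨l, _, rfl⟩ hkl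
    rw [hT, hT]
    rcases lt_trichotomy k l with hl | rfl | hl
    · exact ht.disjoint_seg (h.strictMono.monotone hl)
    · exact absurd rfl hkl
    · exact (ht.disjoint_seg (h.strictMono.monotone hl)).symm

theorem sg_subset (h : Cuts P t s b) (ht : IsChain P t) {i j : ℕ} (hij : i ≤ j) :
    P.Sg (seg s i j) ⊆ P.Sg (seg t (b i) (b j)) := by
  obtain ⟨T, hT, hU⟩ := h.exists_cover ht
  rw [← hU i j hij]
  refine P.Sg_trans _ ((h.chain ht).seg_subset _ _) (seg_countable _ _ _) T ?_
  rintro _ ⟨k, _, rfl⟩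
  rw [hT]
  exact ⟨ht.seg_subset _ _, seg_countable _ _ _, h.mem k⟩

theorem refl (ht : IsChain P t) : Cuts P t t id :=
  ⟨strictMono_id, fun i => by
    rw [id, id, seg_succ]
    exact P.Sg_self _ (ht.mem i)⟩

theorem trans (h : Cuts P t s b) (ht : IsChain P t) {c : ℕ → ℕ} (h' : Cuts P s r c) :
    Cuts P t r (b ∘ c) :=
  ⟨h.strictMono.comp h'.strictMono, fun i =>
    h.sg_subset ht (h'.strictMono.monotone (Nat.le_succ i)) (h'.mem i)⟩

theorem shift (h : Cuts P t s b) {k : ℕ} (m : ℕ) (hk : k ≤ b m) :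
    Cuts P (shift t k) (shift s m) fun i => b (m + i) - k := by
  have hb : ∀ i, k ≤ b (m + i) := fun i => hk.trans (h.strictMono.monotone (by omega))
  refine ⟨strictMono_nat_of_lt_succ fun i => ?_, fun i => ?_⟩
  · have := h.strictMono (show m + i < m + (i + 1) by omega)
    have := hb i
    omega
  · have h1 := hb i
    have h2 := hb (i + 1)
    rw [seg_shift, Nat.add_sub_cancel' h1, Nat.add_sub_cancel' h2]
    exact h.mem (m + i)

theorem of_shift {k : ℕ} (h : Cuts P (Creatures.shift t k) s b) :
    Cuts P t s fun i => k + b i :=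
  ⟨fun i j hij => Nat.add_lt_add_left (h.strictMono hij) k, fun i => by
    rw [← seg_shift]; exact h.mem i⟩

end Cuts

namespace Ref

theorem exists_cuts (h : Ref P t s) (ht : IsChain P t) : ∃ b, b 0 = 0 ∧ Cuts P t s b := by
  obtain ⟨b, hb⟩ := ht.exists_cuts h.chain h.local_mem
  exact ⟨b, ht.mdn_inj (by rw [← hb.mdn_eq ht, h.mdn_zero]), hb⟩

theorem rfl (ht : IsChain P t) : Ref P t t := (Cuts.refl ht).ref ht (by simp)

theorem trans (h : Ref P t s) (ht : IsChain P t) (h' : Ref P s r) : Ref P t r := by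
  obtain ⟨b, hb0, hb⟩ := h.exists_cuts ht
  obtain ⟨c, hc0, hc⟩ := h'.exists_cuts h.chain
  exact (hb.trans ht hc).ref ht (by simp [hb0, hc0])

end Ref

/-- A sequence which agrees with `t` below `m` and continues with `s`. -/
def cat (m : ℕ) (t s : ℕ → WeakCreature H D) : ℕ → WeakCreature H D :=
  fun i => if i < m then t i else s (i - m)

theorem cat_of_lt {m i : ℕ} (h : i < m) : cat m t s i = t i := if_pos h

theorem cat_of_le {m i : ℕ} (h : m ≤ i) : cat m t s i = s (i - m) := if_neg (by omega)

@[simp] theorem shift_cat (m : ℕ) : shift (cat m t s) m = s := by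
  funext i
  rw [shift_apply, cat_of_le (by omega), Nat.add_sub_cancel_left]

theorem seg_cat {m n a : ℕ} (h : n ≤ m) : seg (cat m t s) a n = seg t a n :=
  seg_congr fun _ _ hi => cat_of_lt (by omega)

theorem IsChain.ref_cat (ht : IsChain P t) {m : ℕ} (h : Ref P (Creatures.shift t m) s) :
    Ref P t (cat m t s) := by
  refine ⟨⟨fun i => ?_, fun i => ?_⟩, ?_, fun i => ?_⟩
  · rcases lt_or_ge i m with hi | hi
    · rw [cat_of_lt hi]
      exact ht.mem i
    · rw [cat_of_le hi]
      exact h.chain.mem _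
  · rcases lt_trichotomy (i + 1) m with hi | hi | hi
    · rw [cat_of_lt hi, cat_of_lt (by omega)]
      exact ht.link i
    · rw [cat_of_lt (by omega), cat_of_le hi.ge, hi, Nat.sub_self, h.mdn_zero, ht.link, hi]
      rfl
    · rw [cat_of_le (by omega), cat_of_le (by omega), h.chain.link,
        show i - m + 1 = i + 1 - m by omega]
  · rcases Nat.eq_zero_or_pos m with rfl | hm
    · rw [cat_of_le le_rfl]
      simpa using h.mdn_zero
    · rw [cat_of_lt hm]
  · rcases lt_or_ge i m with hi | hi
    · refine ⟨i, i + 1, by omega, ?_⟩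
      rw [cat_of_lt hi, seg_succ]
      exact P.Sg_self _ (ht.mem i)
    · obtain ⟨a, b, hab, hm⟩ := h.local_mem (i - m)
      rw [seg_shift] at hm
      exact ⟨m + a, m + b, by omega, by rw [cat_of_le hi]; exact hm⟩

theorem IsChain.ref_of_forall (ht : IsChain P t) (h : ∀ i, s i ∈ P.Sg {t i}) : Ref P t s :=
  Cuts.ref (b := id) ⟨strictMono_id, fun i => by rw [id, id, seg_succ]; exact h i⟩ ht (by simp)

end Refinements

/-! ### Stems admissible for a chain -/

section Admissible

variable {α : Type u} {H : ℕ → Set α} {D : Type v} {P : CreatingPair H D}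
  {t s r : ℕ → WeakCreature H D} {x y u : List α}

/-- All the sequences `(x, t_0, …, t_n)` are finite candidates (if `t` is a chain). -/
def Adm (P : CreatingPair H D) (x : List α) (t : ℕ → WeakCreature H D) : Prop :=
  ∀ n, pos P.Sg x (seg t 0 n) ⊆ basis P.Sg (t n)

namespace Adm

theorem mem_basis (h : Adm P x t) : x ∈ basis P.Sg (t 0) :=
  h 0 (by rw [seg_self]; exact IsPos.nil x)

theorem length_eq (h : Adm P x t) (ht : IsChain P t) : x.length = (t 0).mdn :=
  (IsChain.basis_length (ht.mem 0) h.mem_basis).2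

theorem isSeq (h : Adm P x t) (ht : IsChain P t) : IsSeq H x :=
  (IsChain.basis_length (ht.mem 0) h.mem_basis).1

theorem shift (h : Adm P x t) (ht : IsChain P t) {m : ℕ} (hy : y ∈ pos P.Sg x (seg t 0 m)) :
    Adm P y (shift t m) := fun n u hu => by
  rw [seg_shift] at hu
  exact h (m + n) (ht.pos_trans (by omega) (by omega) hy hu)

theorem pos_length (h : Adm P x t) (ht : IsChain P t) {m : ℕ}
    (hy : y ∈ pos P.Sg x (seg t 0 m)) : y.length = (t m).mdn :=
  ht.pos_length (by omega) (h.length_eq ht) hy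

theorem isFC (h : Adm P x t) (ht : IsChain P t) {n : ℕ} (hn : 1 ≤ n) : IsFC P.K P.Sg x t n :=
  ⟨hn, ht.isLinked n, h.mem_basis, fun i _ => h (i + 1)⟩

theorem smooth (h : Adm P x t) (ht : IsChain P t) {m n : ℕ} (hmn : m ≤ n)
    (hu : u ∈ pos P.Sg x (seg t 0 n)) :
    u.take (t m).mdn ∈ pos P.Sg x (seg t 0 m) ∧
      u ∈ pos P.Sg (u.take (t m).mdn) (seg t m n) := by
  rcases hmn.eq_or_lt with rfl | hmn
  · rw [List.take_of_length_le (h.pos_length ht hu).le, seg_self]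
    exact ⟨hu, IsPos.nil u⟩
  · exact P.smooth x n t (h.isFC ht (by omega)) m hmn u hu

theorem pos_nonempty (h : Adm P x t) (ht : IsChain P t) (n : ℕ) :
    (pos P.Sg x (seg t 0 n)).Nonempty := by
  induction n with
  | zero => exact ⟨x, by rw [seg_self]; exact IsPos.nil x⟩
  | succ n ih =>
    obtain ⟨y, hy⟩ := ih
    obtain ⟨u, hu⟩ := pos_singleton_nonempty (h n hy)
    rw [← seg_succ t n] at hu
    exact ⟨u, ht.pos_trans (by omega) (by omega) hy hu⟩

theorem pos_subset_seqs (h : Adm P x t) (ht : IsChain P t) (n : ℕ) :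
    pos P.Sg x (seg t 0 n) ⊆ seqs H (t n).mdn := fun _ hu =>
  ⟨isPos_isSeq hu (h.isSeq ht), h.pos_length ht hu⟩

/-- Composition adds no possibilities, and by niceness it can only enlarge the basis. -/
theorem of_cuts (h : Adm P x t) (ht : IsChain P t) {b : ℕ → ℕ} (hb : Cuts P t s b)
    (hb0 : b 0 = 0) : Adm P x s := fun n u hu => by
  have := hb.pos_subset ht (Nat.zero_le n) hu
  rw [hb0] at this
  exact ht.sg_nice (hb.strictMono (Nat.lt_succ_self n)) (hb.mem n) (h _ this)

theorem of_ref (h : Adm P x t) (ht : IsChain P t) (hs : Ref P t s) : Adm P x s := by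
  obtain ⟨b, hb0, hb⟩ := hs.exists_cuts ht
  exact h.of_cuts ht hb hb0

end Adm

end Admissible

/-! ### Conditions as chains with an admissible stem -/

section Conditions

variable {α : Type u} {H : ℕ → Set α} {D : Type v} {P : CreatingPair H D}

namespace QStar

variable {C : (ℕ → WeakCreature H D) → Prop}

theorem isChain (p : QStar P C) : IsChain P p.t := ⟨p.t_mem, p.link⟩

theorem stem_length (p : QStar P C) : p.stem.length = (p.t 0).mdn :=
  (IsChain.basis_length (p.t_mem 0) p.stem_mem).2

/-- For the index set `[0, n)` the definition of a condition supplies some index, and the length of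
`u` shows that it is `n`. -/
theorem adm (p : QStar P C) : Adm P p.stem p.t := fun n u hu => by
  obtain ⟨i, _, hi⟩ := p.pos_mem _ u hu
  have h1 := p.isChain.pos_length (Nat.zero_le n) p.stem_length hu
  have h2 := (IsChain.basis_length (p.t_mem i) hi).2
  rwa [p.isChain.mdn_inj (h1.symm.trans h2)]

/-- The condition with stem `x` and creatures `t_0, t_1, …`. -/
def mk' (x : List α) (t : ℕ → WeakCreature H D) (ht : IsChain P t) (h : Adm P x t) (hC : C t) :
    QStar P C where
  stem := x
  t := t
  t_mem := ht.mem
  stem_mem := h.mem_basis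
  link := ht.link
  norm_cond := hC
  -- An index set over which there are possibilities is an initial interval `[0, b)`, and `b` is the
  -- index outside it.
  pos_mem := fun I u hu => by
    obtain ⟨b, _, hI, _⟩ := ht.isPos_eq_seg hu 0 (Set.image_subset_range _ _) (h.length_eq ht)
    obtain rfl : I = Set.Ico 0 b := ht.injective.image_injective hI
    exact ⟨b, by simp, h b hu⟩

theorem le_of_cuts {p q : QStar P C} {b : ℕ → ℕ} (hb : Cuts P p.t q.t b)
    (h : q.stem ∈ pos P.Sg p.stem (seg p.t 0 (b 0))) : p ≤ q := by
  refine ⟨Set.Ico 0 (b 0), fun i => Set.Ico (b i) (b (i + 1)), fun i => ?_, fun i j hij => ?_, h,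
    hb.mem⟩
  · have := hb.strictMono.monotone (Nat.zero_le i)
    exact Set.disjoint_left.2 fun x hx hx' => by
      have := hx.2
      have := hx'.1
      omega
  · refine Set.disjoint_left.2 fun x hx hx' => ?_
    have h1 := hx.1
    have h2 := hx.2
    have h3 := hx'.1
    have h4 := hx'.2
    rcases lt_or_gt_of_ne hij with h | h
    · have := hb.strictMono.monotone (Nat.succ_le_of_lt h)
      simp only [Nat.succ_eq_add_one] at this
      omega
    · have := hb.strictMono.monotone (Nat.succ_le_of_lt h)
      simp only [Nat.succ_eq_add_one] at this
      omega

/-- Levels leave no freedom in the order: the index sets are abutting intervals, and the one used up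
by the stem ends where the first of them begins. -/
theorem exists_cuts_of_le {p q : QStar P C} (h : p ≤ q) :
    ∃ b, Cuts P p.t q.t b ∧ q.stem ∈ pos P.Sg p.stem (seg p.t 0 (b 0)) := by
  obtain ⟨S₀, S, _, _, hst, hS⟩ := h
  obtain ⟨b, hb⟩ := p.isChain.exists_cuts q.isChain fun i => by
    obtain ⟨a, b, hab, he⟩ := p.isChain.eq_seg_of_sg_nonempty (Set.image_subset_range _ _)
      ⟨_, hS i⟩
    exact ⟨a, b, hab, he ▸ hS i⟩
  refine ⟨b, hb, ?_⟩
  obtain ⟨c, _, hc, hl⟩ := p.isChain.isPos_eq_seg hst 0 (Set.image_subset_range _ _) p.stem_length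
  obtain rfl : c = b 0 := p.isChain.mdn_inj (by
    rw [← hl, q.stem_length, hb.mdn_eq p.isChain])
  exact hc ▸ hst

theorem le_of_ref {p q : QStar P C} (h : Ref P p.t q.t) (hst : p.stem = q.stem) : p ≤ q := by
  obtain ⟨b, hb0, hb⟩ := h.exists_cuts p.isChain
  refine le_of_cuts hb ?_
  rw [hb0, seg_self, hst]
  exact IsPos.nil _

theorem ref_of_le {p q : QStar P C} (h : p ≤ q) (hst : p.stem = q.stem) : Ref P p.t q.t := by
  obtain ⟨b, hb, _⟩ := exists_cuts_of_le h
  refine hb.ref p.isChain (p.isChain.mdn_inj ?_)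
  rw [← hb.mdn_eq p.isChain, ← q.stem_length, ← p.stem_length, hst]

end QStar

end Conditions

/-! ### Halving: entering or avoiding a set of conditions -/

section Dichotomy

variable {α : Type u} {H : ℕ → Set α} {D : Type v} {P : CreatingPair H D} {f : ℕ → ℕ → ℕ}
  {t s r : ℕ → WeakCreature H D} {E : Set (QF P f)} {x y : List α}

/-- All the conditions `(y, t_m, t_{m+1}, …)` with `y ∈ pos(x, t_0, …, t_{m-1})` are in `E`. -/
def EntersAt (E : Set (QF P f)) (m : ℕ) (x : List α) (t : ℕ → WeakCreature H D) : Prop :=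
  ∀ y ∈ pos P.Sg x (seg t 0 m), ∃ r ∈ E, r.stem = y ∧ r.t = shift t m

/-- The condition `(x, t_0, t_1, …)` is essentially in `E`. -/
def Enters (E : Set (QF P f)) (x : List α) (t : ℕ → WeakCreature H D) : Prop :=
  ∃ m, EntersAt E m x t

/-- No refinement of `(x, t_0, t_1, …)` with the same stem and positive norms is essentially
in `E`. -/
def Avoids (E : Set (QF P f)) (x : List α) (t : ℕ → WeakCreature H D) : Prop :=
  ∀ s, Ref P t s → (∀ i, 0 < (s i).nor) → NormCond H D f s → ¬ Enters E x s

theorem NormCond.shift (h : NormCond H D f t) (m : ℕ) : NormCond H D f (shift t m) := fun k => by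
  obtain ⟨N, hN⟩ := Filter.eventually_atTop.1 (h k)
  exact Filter.eventually_atTop.2 ⟨N, fun i hi => hN (m + i) (by omega)⟩

theorem NormCond.cat (h : NormCond H D f s) (m : ℕ) : NormCond H D f (cat m t s) := fun k => by
  obtain ⟨N, hN⟩ := Filter.eventually_atTop.1 (h k)
  refine Filter.eventually_atTop.2 ⟨N + m, fun i hi => ?_⟩
  rw [cat_of_le (by omega)]
  exact hN _ (by omega)

/-- Smoothness cuts a possibility for `s` at level `m` of `t`. The tail of `t` found there is in
`E`, and the tail of `s` extends it. -/
theorem EntersAt.of_cuts (hE : IsUpperSet E) (ht : IsChain P t) (ha : Adm P x t) {b : ℕ → ℕ}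
    (hb : Cuts P t s b) (hb0 : b 0 = 0) (hN : NormCond H D f s) {m n : ℕ} (hm : m ≤ b n)
    (h : EntersAt E m x t) : EntersAt E n x s := by
  intro y hy
  have hy' := hb.pos_subset ht (Nat.zero_le n) hy
  rw [hb0] at hy'
  obtain ⟨h1, h2⟩ := ha.smooth ht hm hy'
  obtain ⟨r, hr, hrs, hrt⟩ := h _ h1
  have hs := hb.chain ht
  refine ⟨QStar.mk' y (shift s n) (hs.shift n) ((ha.of_cuts ht hb hb0).shift hs hy) (hN.shift n),
    hE ?_ hr, rfl, rfl⟩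
  have hc := hb.shift n hm
  rw [← hrt] at hc
  refine QStar.le_of_cuts hc ?_
  rw [hrs, hrt, seg_shift, add_zero, add_zero, Nat.add_sub_cancel' hm]
  exact h2

theorem EntersAt.mono (hE : IsUpperSet E) (ht : IsChain P t) (ha : Adm P x t)
    (hN : NormCond H D f t) {m n : ℕ} (hm : m ≤ n) (h : EntersAt E m x t) : EntersAt E n x t :=
  h.of_cuts hE ht ha (Cuts.refl ht) rfl hN hm

theorem Enters.of_ref (hE : IsUpperSet E) (ht : IsChain P t) (ha : Adm P x t)
    (hs : Ref P t s) (hN : NormCond H D f s) (h : Enters E x t) : Enters E x s := by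
  obtain ⟨b, hb0, hb⟩ := hs.exists_cuts ht
  obtain ⟨m, hm⟩ := h
  exact ⟨m, hm.of_cuts hE ht ha hb hb0 hN (hb.strictMono.le_apply)⟩

theorem Avoids.of_ref (ht : IsChain P t) (hs : Ref P t s) (h : Avoids E x t) : Avoids E x s :=
  fun r hr => h r (hs.trans ht hr)

/-- There are only finitely many `y`, so the levels at which they enter have a common bound. -/
theorem Enters.of_forall_pos (hE : IsUpperSet E) (hH : IsFinitarySeq H) (ht : IsChain P t)
    (ha : Adm P x t) (hN : NormCond H D f t) {m : ℕ}
    (h : ∀ y ∈ pos P.Sg x (seg t 0 m), Enters E y (shift t m)) : Enters E x t := by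
  choose! n hn using h
  obtain ⟨k, hk⟩ := (((seqs_finite hH _).subset (ha.pos_subset_seqs ht m)).image n).bddAbove
  refine ⟨m + k, fun u hu => ?_⟩
  obtain ⟨h1, h2⟩ := ha.smooth ht (Nat.le_add_right m k) hu
  obtain ⟨r, hr, hru, hrt⟩ := (hn _ h1).mono hE (ht.shift m) (ha.shift ht h1) (hN.shift m)
    (hk ⟨_, h1, rfl⟩) u (by rwa [seg_shift, add_zero])
  exact ⟨r, hr, hru, hrt.trans (shift_shift t m k)⟩

/-- In passing from `t` to `s`, lower bounds for the norms below `f(K, ·)` are divided by at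
most `2 ^ N`. -/
def NormLoss (f : ℕ → ℕ → ℕ) (K N : ℕ) (t s : ℕ → WeakCreature H D) : Prop :=
  ∀ g : ℕ → ℝ, Monotone g → (∀ l, 0 ≤ g l) → (∀ l, g l ≤ f K l) → ∀ L : ℕ,
    (∀ j, L ≤ (t j).mdn → g (t j).mdn < (t j).nor) →
      ∀ i, L ≤ (s i).mdn → g (s i).mdn / 2 ^ N < (s i).nor

/-- The second estimate is applied to `g / 2 ^ N`; for this `NormLoss` speaks of all `g` below `f
K`. -/
theorem NormLoss.trans {K N M : ℕ} (h : NormLoss f K N t s) (h' : NormLoss f K M s r) :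
    NormLoss f K (N + M) t r := by
  intro g hg hg0 hgK L hL i hi
  have h2 : (1 : ℝ) ≤ 2 ^ N := one_le_pow₀ (by norm_num)
  have := h' (fun l => g l / 2 ^ N) (fun a b hab => by have := hg hab; dsimp only; gcongr)
    (fun l => by have := hg0 l; positivity) (fun l => (div_le_self (hg0 l) h2).trans (hgK l)) L
    (h g hg hg0 hgK L hL) i hi
  rwa [div_div, ← pow_add] at this

theorem exists_unhalved {half : WeakCreature H D → WeakCreature H D}
    (hhalf : ∀ (n : ℕ) (t : ℕ → WeakCreature H D), IsLinked P.K t (n + 1) →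
      (∀ i ≤ n, 2 ≤ (t i).nor) →
      ∀ t' ∈ P.Sg (seg (fun i => half (t i)) 0 (n + 1)), 0 < t'.nor →
        ∃ s ∈ P.Sg (seg t 0 (n + 1)), (∃ i ≤ n, (t i).nor / 2 ≤ s.nor) ∧
          ∀ u ∈ basis P.Sg (t 0), pos P.Sg u {s} ⊆ pos P.Sg u {t'})
    (ht : IsChain P t) (h2 : ∀ i, 2 ≤ (t i).nor) {a b : ℕ} (hab : a < b) {c : WeakCreature H D}
    (hc : c ∈ P.Sg (seg (fun i => half (t i)) a b)) (hpos : 0 < c.nor) :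
    ∃ d ∈ P.Sg (seg t a b), (∃ i, a ≤ i ∧ (t i).nor / 2 ≤ d.nor) ∧
      ∀ u ∈ basis P.Sg (t a), pos P.Sg u {d} ⊆ pos P.Sg u {c} := by
  obtain ⟨n, rfl⟩ := Nat.exists_eq_add_of_lt hab
  have hs : ∀ t' : ℕ → WeakCreature H D, seg t' a (a + n + 1) = seg (shift t' a) 0 (n + 1) :=
    fun t' => by rw [seg_shift, add_zero, add_assoc]
  rw [hs] at hc
  obtain ⟨d, hd, ⟨i, _, hi⟩, hu⟩ :=
    hhalf n (shift t a) ((ht.shift a).isLinked _) (fun i _ => h2 _) c hc hpos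
  exact ⟨d, by rwa [hs], ⟨a + i, by omega, hi⟩, by simpa using hu⟩

/-- If the halves avoid `E`, they are the required sequence. Otherwise a refinement `r` of them with
positive norms enters `E`. Un-halving an initial part of `r` keeps it entering, and the norms there
become at least half of norms in `t`. -/
theorem exists_halved (hhalf : P.HasHalving) (hf : IsFast f) (hE : IsUpperSet E)
    (ht : IsChain P t) (hN : NormCond H D f t) (ha : Adm P x t) (h2 : ∀ i, 2 ≤ (t i).nor)
    (K : ℕ) :
    ∃ s, Ref P t s ∧ NormCond H D f s ∧ (Enters E x s ∨ Avoids E x s) ∧ NormLoss f K 1 t s := by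
  obtain ⟨half, hh, hu⟩ := hhalf
  have hr : Ref P t fun i => half (t i) := ht.ref_of_forall fun i => (hh _ (ht.mem i)).1
  have hcuts : Cuts P t (fun i => half (t i)) id :=
    ⟨strictMono_id, fun i => by rw [id, id, seg_succ]; exact (hh _ (ht.mem i)).1⟩
  have hmdn : ∀ i, (half (t i)).mdn = (t i).mdn := hcuts.mdn_eq ht
  by_cases hc : Avoids E x fun i => half (t i)
  · refine ⟨_, hr, fun k => ?_, Or.inr hc, fun g hg hg0 hgK L hL i hi => ?_⟩
    · filter_upwards [hN (k + 1)] with i hi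
      have h1 := (hh _ (ht.mem i)).2
      have h3 : (2 * f k (t i).mdn : ℝ) < f (k + 1) (t i).mdn := by
        exact_mod_cast (hf k (t i).mdn).2
      rw [hmdn]
      linarith
    · have h1 := (hh _ (ht.mem i)).2
      dsimp only at hi ⊢
      rw [hmdn] at hi ⊢
      have := hL i hi
      linarith
  simp only [Avoids, not_forall, not_not] at hc
  obtain ⟨r, hr', hpos, hNr, m, hm⟩ := hc
  obtain ⟨b, hb0, hb⟩ := hr'.exists_cuts hr.chain
  obtain ⟨M₀, hM₀⟩ := Filter.eventually_atTop.1 (hNr K)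
  have hun := fun i => exists_unhalved hu ht h2 (hb.strictMono (Nat.lt_succ_self i)) (hb.mem i)
    (hpos i)
  choose s hs hsn hsp using hun
  -- From `M₀` on, the norms of `r` exceed `f K` and need no repair; from `m` on, `r` has entered
  -- `E`. Only creatures below `M` are un-halved.
  set M := max M₀ m
  set q := cat M s (shift r M)
  have hql : ∀ i < M, q i = s i := fun i hi => cat_of_lt hi
  have hqr : ∀ i, M ≤ i → q i = r i := fun i hi => by
    rw [show q i = shift r M (i - M) from cat_of_le hi, shift_apply, Nat.add_sub_cancel' hi]
  have hq : Cuts P t q b := ⟨hb.strictMono, fun i => by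
    rcases lt_or_ge i M with hi | hi
    · rw [hql i hi]
      exact hs i
    · rw [hqr i hi]
      exact hcuts.sg_subset ht (hb.strictMono (Nat.lt_succ_self i)).le (hb.mem i)⟩
  have haq := ha.of_cuts ht hq hb0
  have hNq : NormCond H D f q := (hNr.shift M).cat M
  have hsub : ∀ n ≤ M, pos P.Sg x (seg q 0 n) ⊆ pos P.Sg x (seg r 0 n) := by
    intro n
    induction n with
    | zero => intro _; rw [seg_self, seg_self]
    | succ n ih =>
      intro hn y hy
      obtain ⟨h3, h4⟩ := haq.smooth (hq.chain ht) (Nat.le_succ n) hy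
      have h5 := hq.pos_subset ht (Nat.zero_le n) h3
      rw [hb0] at h5
      replace h4 : y ∈ pos P.Sg (y.take (q n).mdn) {s n} := by
        rwa [← hql n (by omega), ← seg_succ q n]
      have h6 := hsp n _ (ha _ h5) h4
      rw [← seg_succ r n] at h6
      exact hr'.chain.pos_trans (Nat.zero_le n) (Nat.le_succ n) (ih (by omega) h3) h6
  refine ⟨q, hq.ref ht hb0, hNq, Or.inl ⟨M, fun y hy => ?_⟩, fun g hg hg0 hgK L hL i hi => ?_⟩
  · obtain ⟨r', h3, h4, h5⟩ := hm.mono hE hr'.chain ((ha.of_ref ht hr).of_ref hr.chain hr') hNr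
      (le_max_right M₀ m) y (hsub M le_rfl hy)
    exact ⟨r', h3, h4, h5.trans (shift_cat M).symm⟩
  · rcases lt_or_ge i M with hiM | hiM
    -- The creature `t j` whose half bounds the norm may start later than `q i`, which is harmless
    -- since `g` is monotone.
    · obtain ⟨j, hj, hjn⟩ := hsn i
      have h3 : (q i).mdn ≤ (t j).mdn := by
        rw [hq.mdn_eq ht]
        exact ht.strictMono.monotone hj
      have h4 := hL j (hi.trans h3)
      have h5 := hg h3
      rw [hql i hiM] at h5 ⊢
      linarith
    · have h3 := hM₀ i (le_trans (le_max_left _ _) hiM)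
      have h4 := hgK (q i).mdn
      have h5 := hg0 (q i).mdn
      rw [hqr i hiM] at h4 h5 ⊢
      linarith

/-- Each stem in `V` costs one halving, and a stem once settled stays settled under refinement. The
lower bound on `g` keeps all norms at least 2, as un-halving demands. -/
theorem exists_dichotomy_finset (hhalf : P.HasHalving) (hf : IsFast f) (hE : IsUpperSet E)
    (ht : IsChain P t) (hN : NormCond H D f t) (K : ℕ) (V : Finset (List α))
    (ha : ∀ x ∈ V, Adm P x t) (g : ℕ → ℝ) (hg : Monotone g) (hg0 : ∀ l, 0 ≤ g l)
    (hgK : ∀ l, g l ≤ f K l) (hgt : ∀ j, g (t j).mdn < (t j).nor)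
    (hgV : ∀ l, (t 0).mdn ≤ l → 2 * 2 ^ V.card ≤ g l) :
    ∃ s, Ref P t s ∧ NormCond H D f s ∧ (∀ x ∈ V, Enters E x s ∨ Avoids E x s) ∧
      NormLoss f K V.card t s := by
  classical
  induction V using Finset.induction_on with
  | empty =>
    refine ⟨t, Ref.rfl ht, hN, by simp, fun g _ _ _ L hL i hi => ?_⟩
    simpa using hL i hi
  | insert x V hx ih =>
    rw [Finset.card_insert_of_notMem hx] at hgV ⊢
    have h2 : (2 : ℝ) * 2 ^ V.card ≤ 2 * 2 ^ (V.card + 1) :=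
      mul_le_mul_of_nonneg_left (pow_le_pow_right₀ (by norm_num) (Nat.le_succ _)) (by norm_num)
    obtain ⟨s, hs, hNs, hd, hl⟩ := ih (fun y hy => ha y (Finset.mem_insert_of_mem hy))
      fun l hl => h2.trans (hgV l hl)
    have hs2 : ∀ i, 2 ≤ (s i).nor := fun i => by
      refine le_trans ?_ (hl g hg hg0 hgK 0 (fun j _ => hgt j) i (Nat.zero_le _)).le
      rw [le_div_iff₀ (by positivity)]
      exact h2.trans (hgV _ (hs.mdn_zero ▸ hs.chain.strictMono.monotone (Nat.zero_le i)))
    obtain ⟨r, hr, hNr, hd', hl'⟩ := exists_halved hhalf hf hE hs.chain hNs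
      ((ha x (Finset.mem_insert_self x V)).of_ref ht hs) hs2 K
    refine ⟨r, hs.trans ht hr, hNr, fun y hy => ?_, hl.trans hl'⟩
    rcases Finset.mem_insert.1 hy with rfl | hy
    · exact hd'
    · exact (hd y hy).imp
        (fun h => h.of_ref hE hs.chain ((ha y (Finset.mem_insert_of_mem ‹_›)).of_ref ht hs) hr hNr)
        (fun h => h.of_ref hs.chain hr)

end Dichotomy

theorem exists_seq_of_forall_exists {X : Type*} {I : ℕ → X → Prop} {R : ℕ → X → X → Prop}
    {x₀ : X} (h₀ : I 0 x₀) (h : ∀ n x, I n x → ∃ y, I (n + 1) y ∧ R n x y) :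
    ∃ x : ℕ → X, x 0 = x₀ ∧ (∀ n, I n (x n)) ∧ ∀ n, R n (x n) (x (n + 1)) := by
  choose! F hF hR using h
  let x : ℕ → X := fun n => Nat.rec x₀ F n
  have hx : ∀ n, I n (x n) := fun n => by
    induction n with
    | zero => exact h₀
    | succ n ih => exact hF n _ ih
  exact ⟨x, rfl, hx, fun n => hR n _ (hx n)⟩

/-! ### Growth of fast functions -/

section Fast

variable {α : Type u} {H : ℕ → Set α} {f : ℕ → ℕ → ℕ}

theorem IsFast.monotone_right (hf : IsFast f) (k : ℕ) : Monotone (f k) :=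
  monotone_nat_of_le_succ fun l => (hf k l).1

theorem IsFast.monotone_cast (hf : IsFast f) (k : ℕ) : Monotone fun l => (f k l : ℝ) :=
  fun _ _ hab => Nat.cast_le.2 (hf.monotone_right k hab)

theorem IsFast.strictMono_left (hf : IsFast f) (l : ℕ) : StrictMono fun k => f k l :=
  strictMono_nat_of_lt_succ fun k => by
    have := (hf k l).2
    omega

theorem IsFast.cast_le (hf : IsFast f) {k k' : ℕ} (h : k ≤ k') (l : ℕ) :
    (f k l : ℝ) ≤ f k' l := by
  exact_mod_cast (hf.strictMono_left l).monotone h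

/-- Each step in the first argument of `f` pays for one factor `2 ^ φ`. -/
theorem IsHFast.pow_mul_lt (hf : IsHFast H f) (k l : ℕ) :
    2 ^ (2 * phi H l) * f k l < f (k + 2) l := by
  have h1 := hf.2.2 k l
  have h2 := hf.2.2 (k + 1) l
  calc 2 ^ (2 * phi H l) * f k l = 2 ^ phi H l * (2 ^ phi H l * f k l) := by ring
    _ ≤ 2 ^ phi H l * (f (k + 1) l + phi H l + 2) := by
      gcongr
      refine le_trans ?_ (h1.le.trans (by omega))
      gcongr
      omega
    _ < _ := h2

theorem IsHFast.two_mul_pow_le (hf : IsHFast H f) (k l : ℕ) :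
    2 * 2 ^ (2 * phi H l) ≤ f (k + 2) l := by
  have h1 := hf.2.2 k l
  have h2 := hf.2.2 (k + 1) l
  calc 2 * 2 ^ (2 * phi H l) = 2 ^ phi H l * (2 ^ phi H l * 2) := by ring
    _ ≤ 2 ^ phi H l * (f (k + 1) l + phi H l + 2) := by
      gcongr
      refine le_trans ?_ (h1.le.trans (by omega))
      gcongr
      omega
    _ ≤ _ := h2.le

theorem IsHFast.add_lt (hf : IsHFast H f) (k l : ℕ) : f k l + phi H l + 2 < f (k + 1) l :=
  lt_of_le_of_lt (Nat.le_mul_of_pos_left _ (by positivity)) (hf.2.2 k l)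

end Fast

/-! ### The dichotomy at all levels -/

section Fusion

variable {α : Type u} {H : ℕ → Set α} {D : Type v} {P : CreatingPair H D} {f : ℕ → ℕ → ℕ}
  {t s r : ℕ → WeakCreature H D} {E : Set (QF P f)} {x y : List α}

theorem Ref.shift (h : Ref P t s) (ht : IsChain P t) {m n : ℕ}
    (hmn : (s m).mdn = (t n).mdn) : Ref P (shift t n) (shift s m) := by
  obtain ⟨b, _, hb⟩ := h.exists_cuts ht
  have hbm : b m = n := ht.mdn_inj (by rw [← hb.mdn_eq ht, hmn])
  exact (hb.shift m hbm.ge).ref (ht.shift n) (by simp [hbm])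

/-- The limit of a sequence of successive refinements, the `n`-th of which no longer changes in
the later steps below `n`. -/
theorem Ref.of_eventuallyEq {X : ℕ → ℕ → WeakCreature H D} (hX : ∀ n, IsChain P (X n))
    (h : ∀ n, Ref P (X n) (X (n + 1))) (hs : ∀ i, ∀ᶠ n in Filter.atTop, X n i = s i) (n : ℕ) :
    Ref P (X n) s := by
  have hR : ∀ m, n ≤ m → Ref P (X n) (X m) := fun m hm => by
    induction m, hm using Nat.le_induction with
    | base => exact Ref.rfl (hX n)
    | succ m _ ih => exact ih.trans (hX n) (h m)
  refine ⟨⟨fun i => ?_, fun i => ?_⟩, ?_, fun i => ?_⟩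
  · obtain ⟨m, hm⟩ := (hs i).exists
    exact hm ▸ (hX m).mem i
  · obtain ⟨m, hm, hm'⟩ := ((hs i).and (hs (i + 1))).exists
    exact hm ▸ hm' ▸ (hX m).link i
  · obtain ⟨m, hm, hnm⟩ := ((hs 0).and (Filter.eventually_ge_atTop n)).exists
    exact hm ▸ (hR m hnm).mdn_zero
  · obtain ⟨m, hm, hnm⟩ := ((hs i).and (Filter.eventually_ge_atTop n)).exists
    exact hm ▸ (hR m hnm).local_mem i

theorem NormLoss.mono {K N M : ℕ} (h : NormLoss f K N t s) (hNM : N ≤ M) :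
    NormLoss f K M t s := fun g hg hg0 hgK L hL i hi =>
  lt_of_le_of_lt (div_le_div_of_nonneg_left (hg0 _) (by positivity)
    (pow_le_pow_right₀ (by norm_num) hNM)) (h g hg hg0 hgK L hL i hi)

/-- The number of halvings which `t_i` has undergone before the `n`-th step of the fusion. -/
noncomputable def halvings (t : ℕ → WeakCreature H D) (n : ℕ) : ℕ :=
  ∑ i ∈ Finset.range n, phi H (t i).mdn

theorem halvings_congr {n : ℕ} (h : ∀ i < n, s i = t i) : halvings s n = halvings t n :=
  Finset.sum_congr rfl fun i hi => by rw [h i (Finset.mem_range.1 hi)]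

/-- One step of the fusion. -/
structure FusionStep (P : CreatingPair H D) (f : ℕ → ℕ → ℕ) (K i : ℕ)
    (t s : ℕ → WeakCreature H D) : Prop where
  ref : Ref P t s
  eq_of_lt : ∀ j < i, s j = t j
  mdn_eq : (s i).mdn = (t i).mdn
  loss : NormLoss f K (phi H (t i).mdn) (shift t i) (shift s i)

theorem FusionStep.halvings_eq {K i : ℕ} (h : FusionStep P f K i t s) :
    halvings s (i + 1) = halvings t i + phi H (t i).mdn := by
  rw [halvings, Finset.sum_range_succ, h.mdn_eq]
  congr 1
  exact halvings_congr h.eq_of_lt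

theorem FusionStep.norm_lt {K i : ℕ} (h : FusionStep P f K i t s) {g : ℕ → ℝ}
    (hg : Monotone g) (hg0 : ∀ l, 0 ≤ g l) (hgK : ∀ l, g l ≤ f K l) {L : ℕ}
    (hL : ∀ j, i ≤ j + 1 → L ≤ (t j).mdn → g (t j).mdn / 2 ^ halvings t i < (t j).nor) :
    ∀ j, i + 1 ≤ j + 1 → L ≤ (s j).mdn → g (s j).mdn / 2 ^ halvings s (i + 1) < (s j).nor := by
  intro j hj hLj
  obtain ⟨j, rfl⟩ := Nat.exists_eq_add_of_le (show i ≤ j by omega)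
  have h2 : (1 : ℝ) ≤ 2 ^ halvings t i := one_le_pow₀ (by norm_num)
  have := h.loss (fun l => g l / 2 ^ halvings t i)
    (fun a b hab => by have := hg hab; dsimp only; gcongr)
    (fun l => by have := hg0 l; positivity) (fun l => (div_le_self (hg0 l) h2).trans (hgK l)) L
    (fun j hj => hL (i + j) (by omega) hj) j hLj
  rwa [div_div, ← pow_add, ← h.halvings_eq] at this

/-- The possibilities at level `i`, over all stems in `U`, are sequences of one length, hence at
most `φ` many. With the halvings already spent this makes at most `2φ`, so the norms stay above 2.
-/
theorem exists_fusionStep (hH : ∀ m, (H m).Nontrivial) (hhalf : P.HasHalving)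
    (hf : IsHFast H f) (hE : IsUpperSet E) {U : Set (List α)} (ht : IsChain P t)
    (hN : NormCond H D f t) (hU : ∀ u ∈ U, Adm P u t) (k i : ℕ)
    (hL : ∀ j, i ≤ j + 1 → f (k + 2) (t j).mdn / 2 ^ halvings t i < (t j).nor) :
    ∃ s, NormCond H D f s ∧ FusionStep P f (k + 2 + i) i t s ∧
      ∀ u ∈ U, ∀ y ∈ pos P.Sg u (seg t 0 i),
        Enters E y (shift s i) ∨ Avoids E y (shift s i) := by
  have hfin := hf.2.1
  set V : Set (List α) := ⋃ u ∈ U, pos P.Sg u (seg t 0 i)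
  have hVs : V ⊆ seqs H (t i).mdn :=
    Set.iUnion₂_subset fun u hu => (hU u hu).pos_subset_seqs ht i
  have hV : V.Finite := (seqs_finite hfin _).subset hVs
  have hcard : hV.toFinset.card ≤ phi H (t i).mdn := by
    rw [← Set.ncard_eq_toFinset_card V hV]
    exact Set.ncard_le_ncard hVs (seqs_finite hfin _)
  have hsum : halvings t i + phi H (t i).mdn ≤ 2 * phi H (t i).mdn := by
    rw [halvings, ← Finset.sum_range_succ (fun j => phi H (t j).mdn)]
    exact sum_phi_le hfin hH ht.strictMono i
  have hpow : (1 : ℝ) ≤ 2 ^ halvings t i := one_le_pow₀ (by norm_num)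
  obtain ⟨s, hs, hNs, hd, hl⟩ := exists_dichotomy_finset hhalf hf.1 hE (ht.shift i) (hN.shift i)
    (k + 2 + i) hV.toFinset (fun y hy => by
      rw [Set.Finite.mem_toFinset, Set.mem_iUnion₂] at hy
      obtain ⟨u, hu, hy⟩ := hy
      exact (hU u hu).shift ht hy)
    (fun l => (f (k + 2) l : ℝ) / 2 ^ halvings t i)
    (fun a b hab => by
      have : (f (k + 2) a : ℝ) ≤ f (k + 2) b := by exact_mod_cast hf.1.monotone_right _ hab
      dsimp only
      gcongr)
    (fun l => by positivity)
    (fun l => (div_le_self (by positivity) hpow).trans (by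
      exact_mod_cast (hf.1.strictMono_left l).monotone (Nat.le_add_right _ _)))
    (fun j => hL (i + j) (by omega))
    (fun l hl => by
      rw [le_div_iff₀ (by positivity), mul_assoc, ← pow_add]
      have h1 := phi_mono hfin hH hl
      simp only [shift_apply, add_zero] at h1
      calc (2 : ℝ) * 2 ^ (hV.toFinset.card + halvings t i) ≤ 2 * 2 ^ (2 * phi H l) := by
            gcongr
            · norm_num
            · omega
        _ ≤ f (k + 2) l := by exact_mod_cast hf.two_mul_pow_le k l)
  refine ⟨cat i t s, hNs.cat i, ⟨ht.ref_cat hs, fun j hj => cat_of_lt hj, ?_, ?_⟩,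
    fun u hu y hy => ?_⟩
  · rw [cat_of_le le_rfl, Nat.sub_self, hs.mdn_zero]
    rfl
  · rw [shift_cat]
    exact hl.mono hcard
  · rw [shift_cat]
    exact hd y (by
      rw [Set.Finite.mem_toFinset, Set.mem_iUnion₂]
      exact ⟨u, hu, hy⟩)

theorem exists_dichotomy (hH : ∀ m, (H m).Nontrivial) (hhalf : P.HasHalving)
    (hf : IsHFast H f) (hE : IsUpperSet E) {U : Set (List α)} (ht : IsChain P t)
    (hN : NormCond H D f t) (hU : ∀ u ∈ U, Adm P u t) (k : ℕ)
    (hn : ∀ j, f (k + 2) (t j).mdn < (t j).nor) :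
    ∃ s, Ref P t s ∧ NormCond H D f s ∧ (∀ i, f k (s i).mdn < (s i).nor) ∧
      ∀ m, ∀ u ∈ U, ∀ y ∈ pos P.Sg u (seg s 0 m),
        Enters E y (shift s m) ∨ Avoids E y (shift s m) := by
  obtain ⟨X, hX0, hX, hR⟩ := exists_seq_of_forall_exists
    (I := fun i T => Ref P t T ∧ NormCond H D f T ∧
      -- The bound reaches down to index `i - 1`: at stage `i + 1` it must still cover the creature
      -- at `i`, which is now final.
      ∀ j, i ≤ j + 1 → (f (k + 2) (T j).mdn / 2 ^ halvings T i : ℝ) < (T j).nor)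
    (R := fun i T S => FusionStep P f (k + 2 + i) i T S ∧
      ∀ u ∈ U, ∀ y ∈ pos P.Sg u (seg T 0 i),
        Enters E y (shift S i) ∨ Avoids E y (shift S i))
    (x₀ := t) ⟨Ref.rfl ht, hN, fun j _ => by simpa [halvings] using hn j⟩ (by
      rintro i T ⟨hT, hNT, hL⟩
      obtain ⟨S, hNS, hS, hd⟩ := exists_fusionStep hH hhalf hf hE hT.chain hNT
        (fun u hu => (hU u hu).of_ref ht hT) k i hL
      refine ⟨S, ⟨hT.trans ht hS.ref, hNS, fun j hj => ?_⟩, hS, hd⟩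
      exact hS.norm_lt (g := fun l => f (k + 2) l) (L := 0)
        (hf.1.monotone_cast _) (fun l => by positivity)
        (fun l => by exact_mod_cast (hf.1.strictMono_left l).monotone (Nat.le_add_right _ _))
        (fun j hj _ => hL j hj) j hj (Nat.zero_le _))
  have hXc : ∀ n, IsChain P (X n) := fun n => (hX n).1.chain
  have hconst : ∀ i n, i + 1 ≤ n → X n i = X (i + 1) i := fun i n hn => by
    induction n, hn using Nat.le_induction with
    | base => rfl
    | succ n hn ih => rw [(hR n).1.eq_of_lt i (by omega), ih]
  set s : ℕ → WeakCreature H D := fun i => X (i + 1) i with hs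
  have href : ∀ n, Ref P (X n) s := Ref.of_eventuallyEq hXc (fun n => (hR n).1.ref) fun i =>
    Filter.eventually_atTop.2 ⟨i + 1, hconst i⟩
  have hst : Ref P t s := hX0 ▸ href 0
  have hnorm : ∀ i₀ L : ℕ, ∀ g : ℕ → ℝ, Monotone g → (∀ l, 0 ≤ g l) →
      (∀ l, g l ≤ f (k + 2 + i₀) l) → (∀ j, L ≤ (X i₀ j).mdn → g (X i₀ j).mdn < (X i₀ j).nor) →
      ∀ i, i₀ ≤ i → L ≤ (s i).mdn → g (s i).mdn / 2 ^ (2 * phi H (s i).mdn) < (s i).nor := by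
    intro i₀ L g hg hg0 hgK hL i hi hLi
    have key : ∀ n, i₀ ≤ n → ∀ j, n ≤ j + 1 → L ≤ (X n j).mdn →
        g (X n j).mdn / 2 ^ halvings (X n) n < (X n j).nor := fun n hn => by
      induction n, hn using Nat.le_induction with
      | base =>
        exact fun j _ hj => lt_of_le_of_lt
          (div_le_self (hg0 _) (one_le_pow₀ (by norm_num))) (hL j hj)
      | succ n hn ih =>
        exact (hR n).1.norm_lt hg hg0 (fun l => (hgK l).trans (by
          exact_mod_cast (hf.1.strictMono_left l).monotone (by omega))) ih
    refine lt_of_le_of_lt ?_ (key (i + 1) (by omega) i le_rfl hLi)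
    refine div_le_div_of_nonneg_left (hg0 _) (by positivity)
      (pow_le_pow_right₀ (by norm_num) ?_)
    exact sum_phi_le hf.2.1 hH (hXc (i + 1)).strictMono i
  have hdiv : ∀ K l : ℕ, (f K l : ℝ) < f (K + 2) l / 2 ^ (2 * phi H l) := fun K l => by
    rw [lt_div_iff₀ (by positivity), mul_comm]
    exact_mod_cast hf.pow_mul_lt K l
  -- For given `K`, losses are counted from stage `K` on. There the cap `f (k + 2 + K)` admits `g =
  -- f (K + 2)`, which `X K` eventually exceeds; hence the cap grows with the stage.
  have hNs : NormCond H D f s := fun K => by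
    obtain ⟨N, hN'⟩ := Filter.eventually_atTop.1 ((hX K).2.1 (K + 2))
    refine Filter.eventually_atTop.2 ⟨max K (X K N).mdn, fun i hi => ?_⟩
    refine (hdiv K _).trans (hnorm K (X K N).mdn (fun l => f (K + 2) l)
      (hf.1.monotone_cast _) (fun l => by positivity)
      (fun l => by exact_mod_cast (hf.1.strictMono_left l).monotone (by omega))
      (fun j hj => hN' j ((hXc K).strictMono.le_iff_le.1 hj)) i (le_trans (le_max_left _ _) hi)
      ((le_max_right _ _).trans (hi.trans hst.chain.strictMono.le_apply)))
  refine ⟨s, hst, hNs, fun i => ?_, fun m u hu y hy => ?_⟩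
  · refine (hdiv k _).trans (hnorm 0 0 (fun l => f (k + 2) l)
      (hf.1.monotone_cast _) (fun l => by positivity)
      (fun l => le_rfl) (fun j _ => by rw [hX0]; exact hn j) i (Nat.zero_le _) (Nat.zero_le _))
  · have hseg : seg s 0 m = seg (X m) 0 m := seg_congr fun i _ hi => (hconst i m hi).symm
    rw [hseg] at hy
    have hr : Ref P (shift (X (m + 1)) m) (shift s m) := (href (m + 1)).shift (hXc _) rfl
    have ha : Adm P y (shift (X (m + 1)) m) := by
      have h1 : seg (X m) 0 m = seg (X (m + 1)) 0 m :=
        seg_congr fun i _ hi => ((hR m).1.eq_of_lt i hi).symm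
      rw [h1] at hy
      exact ((hU u hu).of_ref ht (hX (m + 1)).1).shift (hXc _) hy
    exact ((hR m).2 u hu y hy).imp
      (fun h => h.of_ref hE ((hXc _).shift m) ha hr (hNs.shift m))
      (fun h => h.of_ref ((hXc _).shift m) hr)

end Fusion

/-! ### Bigness and homogeneous creatures -/

section Homogeneous

variable {α : Type u} {H : ℕ → Set α} {D : Type v} {P : CreatingPair H D}

theorem CreatingPair.sg_singleton_subset {c d : WeakCreature H D} (hc : c ∈ P.K)
    (hd : d ∈ P.Sg {c}) : P.Sg {d} ⊆ P.Sg {c} := by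
  have hdK := P.Sg_subset {c} (by simpa using hc) (Set.countable_singleton c) hd
  simpa using P.Sg_trans {d} (by simpa using hdK) (Set.countable_singleton d) (fun _ => {c})
    (by simpa using ⟨hc, hd⟩)

theorem CreatingPair.pos_singleton_subset {c d : WeakCreature H D} (hc : c ∈ P.K)
    (hd : d ∈ P.Sg {c}) (x : List α) : pos P.Sg x {d} ⊆ pos P.Sg x {c} := by
  intro u hu
  rw [mem_pos_singleton] at hu ⊢
  obtain ⟨s, hs, hxu⟩ := hu
  exact ⟨s, P.sg_singleton_subset hc hd hs, hxu⟩

theorem CreatingPair.basis_subset {c d : WeakCreature H D} (hc : c ∈ P.K)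
    (hd : d ∈ P.Sg {c}) : basis P.Sg c ⊆ basis P.Sg d :=
  P.nice 0 (fun _ => c) ⟨fun _ _ => hc, fun i hi => by omega⟩ d (by rwa [seg_succ])

/-- Bigness is used once for each stem in `V`, each time at a cost of 1 in norm; niceness keeps the
remaining stems in the basis. -/
theorem CreatingPair.IsBig.exists_homogeneous (hbig : P.IsBig fun _ => 2)
    {c : WeakCreature H D} (hc : c ∈ P.K) (Q : List α → Prop) (V : Finset (List α))
    (hV : ∀ x ∈ V, x ∈ basis P.Sg c) (hn : V.card < c.nor) :
    ∃ d ∈ P.Sg {c}, c.nor - V.card ≤ d.nor ∧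
      ∀ x ∈ V, (∀ y ∈ pos P.Sg x {d}, Q y) ∨ ∀ y ∈ pos P.Sg x {d}, ¬ Q y := by
  classical
  induction V using Finset.induction_on with
  | empty => exact ⟨c, P.Sg_self c hc, by simp, by simp⟩
  | insert x V hx ih =>
    rw [Finset.card_insert_of_notMem hx] at hn ⊢
    push_cast at hn ⊢
    obtain ⟨d, hd, hdn, hdV⟩ := ih (fun y hy => hV y (Finset.mem_insert_of_mem hy)) (by linarith)
    have hdK := P.Sg_subset {c} (by simpa using hc) (Set.countable_singleton c) hd
    obtain ⟨e, he, hen, a, ha⟩ := hbig d hdK (by linarith) x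
      (P.basis_subset hc hd (hV x (Finset.mem_insert_self x V)))
      fun y => if Q y then (0 : Fin 2) else 1
    have hsub := P.pos_singleton_subset hdK he
    refine ⟨e, P.sg_singleton_subset hc hd he, by linarith, fun y hy => ?_⟩
    rcases Finset.mem_insert.1 hy with rfl | hy
    · by_cases h0 : a = (0 : Fin 2)
      · refine Or.inl fun z hz => by_contra fun hQ => ?_
        have := ha ⟨z, hsub _ hz⟩ hz
        simp [hQ, h0] at this
      · refine Or.inr fun z hz hQ => h0 ?_
        have := ha ⟨z, hsub _ hz⟩ hz
        simpa [hQ, eq_comm] using this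
    · exact (hdV y hy).imp (fun h z hz => h z (hsub _ hz)) (fun h z hz => h z (hsub _ hz))

end Homogeneous

/-! ### Entering a dense set -/

section Entering

variable {α : Type u} {H : ℕ → Set α} {D : Type v} {P : CreatingPair H D} {f : ℕ → ℕ → ℕ}
  {t : ℕ → WeakCreature H D} {E : Set (QF P f)}

/-- The condition `(y, t_m, t_{m+1}, …)` for `y ∈ pos(w, t_0, …, t_{m-1})`. -/
def QF.tail (p : QF P f) (m : ℕ) (y : List α) (hy : y ∈ pos P.Sg p.stem (seg p.t 0 m)) : QF P f :=
  QStar.mk' y (shift p.t m) (p.isChain.shift m) (p.adm.shift p.isChain hy) (p.norm_cond.shift m)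

theorem QF.le_tail (p : QF P f) {m : ℕ} {y : List α}
    (hy : y ∈ pos P.Sg p.stem (seg p.t 0 m)) : p ≤ p.tail m y hy :=
  QStar.le_of_cuts ((Cuts.refl (p.isChain.shift m)).of_shift) hy

/-- The sequence `s` from the dichotomy already works. The homogeneous sequence `r` serves only to
refute avoidance; the gap between `f (k + 1)` and `f k` leaves room for the up to `φ` uses of
bigness at each level. -/
theorem exists_enters (hH : ∀ m, (H m).Nontrivial) (hbig : P.IsBig fun _ => 2)
    (hhalf : P.HasHalving) (hf : IsHFast H f) (hE : IsUpperSet E) (hd : IsDenseSet E)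
    {U : Set (List α)} (ht : IsChain P t) (hN : NormCond H D f t) (hU : ∀ u ∈ U, Adm P u t)
    (k : ℕ) (hn : ∀ j, f (k + 3) (t j).mdn < (t j).nor) :
    ∃ s, Ref P t s ∧ NormCond H D f s ∧ (∀ i, f (k + 1) (s i).mdn < (s i).nor) ∧
      ∀ u ∈ U, Enters E u s := by
  obtain ⟨s, hs, hNs, hns, hdich⟩ := exists_dichotomy hH hhalf hf hE ht hN hU (k + 1) hn
  refine ⟨s, hs, hNs, hns, fun u hu => ?_⟩
  have ha : Adm P u s := (hU u hu).of_ref ht hs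
  have h0 := hdich 0 u hu u (by rw [seg_self]; exact IsPos.nil u)
  rw [shift_zero] at h0
  refine h0.resolve_right fun havoid => ?_
  have hfin := hf.2.1
  have hnφ : ∀ i, (f k (s i).mdn + phi H (s i).mdn + 2 : ℝ) < (s i).nor := fun i =>
    lt_trans (by exact_mod_cast hf.add_lt k (s i).mdn) (hns i)
  have hhom : ∀ i, ∃ d ∈ P.Sg {s i}, (s i).nor - phi H (s i).mdn ≤ d.nor ∧
      ∀ x ∈ pos P.Sg u (seg s 0 i), (∀ y ∈ pos P.Sg x {d}, Enters E y (shift s (i + 1))) ∨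
        ∀ y ∈ pos P.Sg x {d}, ¬ Enters E y (shift s (i + 1)) := fun i => by
    have hsub := ha.pos_subset_seqs hs.chain i
    have hV : (pos P.Sg u (seg s 0 i)).Finite := (seqs_finite hfin _).subset hsub
    have hcard : (hV.toFinset.card : ℝ) ≤ phi H (s i).mdn := by
      rw [← Set.ncard_eq_toFinset_card _ hV]
      exact_mod_cast Set.ncard_le_ncard hsub (seqs_finite hfin _)
    have hf0 : (0 : ℝ) ≤ f k (s i).mdn := by positivity
    obtain ⟨d, hd, hdn, hdV⟩ := hbig.exists_homogeneous (hs.chain.mem i)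
      (fun y => Enters E y (shift s (i + 1))) hV.toFinset
      (fun x hx => ha i (hV.mem_toFinset.1 hx)) (by linarith [hnφ i])
    exact ⟨d, hd, by linarith, fun x hx => hdV x (hV.mem_toFinset.2 hx)⟩
  choose r hr hrn hrh using hhom
  have hcr : Cuts P s r id :=
    ⟨strictMono_id, fun i => by rw [id, id, seg_succ]; exact hr i⟩
  have hsr : Ref P s r := hcr.ref hs.chain rfl
  have hmdn : ∀ i, (r i).mdn = (s i).mdn := hcr.mdn_eq hs.chain
  have har : Adm P u r := ha.of_ref hs.chain hsr
  have hNr : NormCond H D f r := fun K => by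
    filter_upwards [hNs (K + 1)] with i hi
    have : (f K (s i).mdn + phi H (s i).mdn + 2 : ℝ) < f (K + 1) (s i).mdn := by
      exact_mod_cast hf.add_lt K (s i).mdn
    rw [hmdn]
    linarith [hrn i]
  have hpos : ∀ i, 0 < (s i).nor ∧ 0 < (r i).nor := fun i => by
    have hf0 : (0 : ℝ) ≤ f k (s i).mdn := by positivity
    have hf1 : (0 : ℝ) ≤ phi H (s i).mdn := by positivity
    constructor <;> linarith [hrn i, hnφ i]
  -- If all possibilities inside `r m` entered, replacing just `s m` by `r m` would refute avoidance
  -- one level below. So none enters, and by the dichotomy each avoids.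
  have key : ∀ m, ∀ y ∈ pos P.Sg u (seg r 0 m), Avoids E y (shift s m) := by
    intro m
    induction m with
    | zero =>
      intro y hy
      rw [seg_self, pos_empty, Set.mem_singleton_iff] at hy
      rwa [hy, shift_zero]
    | succ m ih =>
      intro y hy
      obtain ⟨h1, h2⟩ := har.smooth hsr.chain (Nat.le_succ m) hy
      rw [seg_succ] at h2
      have h3 := hcr.pos_subset hs.chain (Nat.zero_le m) h1
      have h4 := hcr.pos_subset hs.chain (Nat.zero_le (m + 1)) hy
      rcases hrh m _ h3 with h | h
      · have hq : Ref P (shift s m) (cat 1 (shift r m) (shift s (m + 1))) := by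
          refine (hs.chain.shift m).ref_of_forall fun i => ?_
          rcases i with _ | i
          · exact hr m
          · rw [cat_of_le (by omega), shift_apply, shift_apply,
              show m + 1 + (i + 1 - 1) = m + (i + 1) by omega]
            exact P.Sg_self _ (hs.chain.mem _)
        refine absurd ?_ (ih _ h1 _ hq (fun i => ?_) ((hNs.shift _).cat 1))
        · refine Enters.of_forall_pos hE hfin hq.chain
            ((ha.shift hs.chain h3).of_ref (hs.chain.shift m) hq) ((hNs.shift _).cat 1)
            (m := 1) fun z hz => ?_
          rw [shift_cat]
          refine h z ?_
          rw [seg_cat le_rfl, seg_shift] at hz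
          rwa [← seg_succ r m]
        · rcases lt_or_ge i 1 with hi | hi
          · rw [cat_of_lt hi]
            exact (hpos _).2
          · rw [cat_of_le hi]
            exact (hpos _).1
      · exact (hdich (m + 1) u hu y h4).resolve_left (h y h2)
  -- From `N` on, the norms of `q ∈ E` are positive, so its tail is a refinement that avoidance
  -- forbids.
  obtain ⟨q, hqE, hq⟩ := hd (QStar.mk' u r hsr.chain har hNr)
  obtain ⟨b, hb, hbst⟩ := QStar.exists_cuts_of_le hq
  obtain ⟨N, hN'⟩ := Filter.eventually_atTop.1 (q.norm_cond 0)
  obtain ⟨y, hy⟩ := q.adm.pos_nonempty q.isChain N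
  have hyb : y ∈ pos P.Sg u (seg r 0 (b N)) :=
    hsr.chain.pos_trans (Nat.zero_le _) (hb.strictMono.monotone (Nat.zero_le N)) hbst
      (hb.pos_subset hsr.chain (Nat.zero_le N) hy)
  refine key (b N) y hyb (shift q.t N) ?_ (fun i => ?_) (q.norm_cond.shift N) ⟨0, fun z hz => ?_⟩
  · exact (hsr.shift hs.chain (hmdn (b N))).trans (hs.chain.shift _)
      ((hb.shift N le_rfl).ref (hsr.chain.shift _) (by simp))
  · exact lt_of_le_of_lt (Nat.cast_nonneg _) (hN' (N + i) (by omega))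
  · rw [seg_self, pos_empty, Set.mem_singleton_iff] at hz
    exact ⟨q.tail N y hy, hE (q.le_tail hy) hqE, hz.symm, (shift_zero _).symm⟩

theorem exists_lEn_enters (hH : ∀ m, (H m).Nontrivial) (hbig : P.IsBig fun _ => 2)
    (hhalf : P.HasHalving) (hf : IsHFast H f) (hE : IsUpperSet E) (hd : IsDenseSet E)
    (p : QF P f) (k : ℕ) : ∃ q : QF P f, QF.LEn (k + 1) p q ∧ Enters E q.stem q.t := by
  obtain ⟨N, hN⟩ := Filter.eventually_atTop.1 (p.norm_cond (k + 3))
  -- Nothing below `M` changes, which protects the creatures that must be kept; from `M` on, the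
  -- norms suffice for `exists_enters`, which treats all stems at that level with one common tail.
  set M := max N (sInf {i : ℕ | (f (k + 1) (p.t i).mdn : ℝ) < (p.t i).nor} + 1)
  obtain ⟨s, hs, hNs, hns, hent⟩ := exists_enters hH hbig hhalf hf hE hd
    (U := pos P.Sg p.stem (seg p.t 0 M)) (p.isChain.shift M) (p.norm_cond.shift M)
    (fun u hu => p.adm.shift p.isChain hu) k
    (fun j => hN (M + j) ((le_max_left _ _).trans (Nat.le_add_right _ _)))
  have hr := p.isChain.ref_cat hs
  have ha := p.adm.of_ref p.isChain hr
  have hNr : NormCond H D f (cat M p.t s) := hNs.cat M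
  refine ⟨QStar.mk' p.stem (cat M p.t s) hr.chain ha hNr, ⟨⟨QStar.le_of_ref hr rfl, rfl⟩,
    fun j hj => (cat_of_lt ?_).symm, fun i hi => ?_⟩, ?_⟩
  · exact lt_of_lt_of_le (Nat.lt_succ_of_le hj) (le_max_right N _)
  · change (cat M p.t s i).nor ≤ f (k + 1) (cat M p.t s i).mdn at hi
    rcases lt_or_ge i M with hiM | hiM
    · exact ⟨i, (cat_of_lt hiM).symm⟩
    · rw [cat_of_le hiM] at hi
      exact absurd (hns _) (not_lt.2 hi)
  · refine Enters.of_forall_pos hE hf.2.1 hr.chain ha hNr (m := M) fun y hy => ?_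
    change y ∈ pos P.Sg p.stem (seg (cat M p.t s) 0 M) at hy
    change Enters E y (shift (cat M p.t s) M)
    rw [shift_cat]
    exact hent y (by rwa [seg_cat le_rfl] at hy)

end Entering

/-! ### Limits of fusion sequences -/

section Limits

variable {α : Type u} {H : ℕ → Set α} {D : Type v} {P : CreatingPair H D} {f : ℕ → ℕ → ℕ}

namespace QF

theorem LEn.le {n : ℕ} {p q : QF P f} (h : LEn n p q) : p ≤ q ∧ p.stem = q.stem := by
  cases n with
  | zero => exact h
  | succ n => exact h.1

/-- The least `i` such that `nor[t^p_i] > f(k, m_dn(t^p_i))`. -/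
noncomputable def start (k : ℕ) (p : QF P f) : ℕ :=
  sInf {i : ℕ | (f k (p.t i).mdn : ℝ) < (p.t i).nor}

theorem start_spec (k : ℕ) (p : QF P f) :
    (f k (p.t (start k p)).mdn : ℝ) < (p.t (start k p)).nor :=
  Nat.sInf_mem (s := {i : ℕ | (f k (p.t i).mdn : ℝ) < (p.t i).nor}) (p.norm_cond k).exists

theorem start_le {k : ℕ} {p : QF P f} {i : ℕ} (h : (f k (p.t i).mdn : ℝ) < (p.t i).nor) :
    start k p ≤ i :=
  Nat.sInf_le h

theorem LEn.pred (hf : IsFast f) {n : ℕ} {p q : QF P f} (h : LEn (n + 1) p q) : LEn n p q := by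
  cases n with
  | zero => exact h.1
  | succ n =>
    refine ⟨h.1, fun j hj => h.2.1 j (hj.trans ?_), fun i hi => h.2.2 i
      (hi.trans (hf.cast_le (Nat.le_succ _) _))⟩
    exact start_le (lt_of_le_of_lt (hf.cast_le (Nat.le_succ _) _) (start_spec (n + 1 + 1) p))

theorem start_mono (hf : IsFast f) {k k' : ℕ} (hk : k ≤ k') {p q : QF P f}
    (h : ∀ j ≤ start k p, p.t j = q.t j) : start k p ≤ start k' q := by
  by_contra! hlt
  refine absurd (start_le (k := k) (p := p) ?_) (not_le.2 hlt)
  rw [h _ hlt.le]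
  exact lt_of_le_of_lt (hf.cast_le hk _) (start_spec k' q)

/-- Step `n` freezes the creatures up to `a n`, and `a` is unbounded, so the sequence converges
pointwise. -/
theorem exists_lEn_limit (hf : IsFast f) {k : ℕ} {q : ℕ → QF P f}
    (h : ∀ n, LEn (k + n + 1) (q n) (q (n + 1))) :
    ∃ r : QF P f, ∀ n, LEn (k + n + 1) (q n) r := by
  set a : ℕ → ℕ := fun n => start (k + n + 1) (q n)
  have hmono : Monotone a := monotone_nat_of_le_succ fun n =>
    start_mono hf (by omega) (h n).2.1
  have hconst : ∀ n j, j ≤ a n → ∀ m, n ≤ m → (q m).t j = (q n).t j := by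
    intro n j hj m hm
    induction m, hm using Nat.le_induction with
    | base => rfl
    | succ m hm ih => rw [← (h m).2.1 j (hj.trans (hmono hm)), ih]
  -- If `a` stuck at `i`, the frozen creature there would have norm above values of `f` whose first
  -- argument grows without bound.
  have hunb : ∀ i, ∃ n, i ≤ a n := by
    intro i
    induction i with
    | zero => exact ⟨0, Nat.zero_le _⟩
    | succ i ih =>
      obtain ⟨n, hn⟩ := ih
      by_contra! hc
      obtain ⟨m, hm⟩ := exists_nat_ge ((q n).t i).nor
      have hai : a (n + m) = i :=
        le_antisymm (Nat.lt_succ_iff.1 (hc _)) (hn.trans (hmono (Nat.le_add_right n m)))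
      have h1 : (f (k + (n + m) + 1) ((q (n + m)).t (a (n + m))).mdn : ℝ) <
        ((q (n + m)).t (a (n + m))).nor := start_spec _ _
      rw [hai, hconst n i hn (n + m) (Nat.le_add_right n m)] at h1
      have h2 : k + (n + m) + 1 ≤ f (k + (n + m) + 1) ((q n).t i).mdn :=
        (hf.strictMono_left _).le_apply
      have h3 : (m : ℝ) ≤ f (k + (n + m) + 1) ((q n).t i).mdn := by
        exact_mod_cast (show m ≤ k + (n + m) + 1 by omega).trans h2
      linarith
  choose N hN using hunb
  have hev : ∀ i, ∀ m, N i ≤ m → (q m).t i = (q (N i)).t i := fun i => hconst (N i) i (hN i)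
  have hstem : ∀ n, (q n).stem = (q 0).stem := fun n => by
    induction n with
    | zero => rfl
    | succ n ih => rw [← (h n).le.2, ih]
  have href : ∀ n, Ref P (q n).t fun i => (q (N i)).t i :=
    Ref.of_eventuallyEq (fun n => (q n).isChain)
      (fun n => QStar.ref_of_le (h n).le.1 (h n).le.2)
      fun i => Filter.eventually_atTop.2 ⟨N i, hev i⟩
  have hback : ∀ n m, n ≤ m → ∀ x ∈ Set.range (q m).t, x.nor ≤ f (k + n + 1) x.mdn →
      x ∈ Set.range (q n).t := by
    intro n m hm
    induction m, hm using Nat.le_induction with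
    | base => exact fun x hx _ => hx
    | succ m hm ih =>
      rintro _ ⟨i, rfl⟩ hx
      exact ih _ ((h m).2.2 i (hx.trans (hf.cast_le (by omega) _))) hx
  have hrange : ∀ n i, ((q (N i)).t i).nor ≤ f (k + n + 1) ((q (N i)).t i).mdn →
      (q (N i)).t i ∈ Set.range (q n).t := fun n i hi =>
    hback n _ (le_max_left n (N i)) _ ⟨i, hev i _ (le_max_right _ _)⟩ hi
  -- A creature of the limit with norm at most `f K` already occurs in `q K`, which has only
  -- finitely many of them.
  have hnorm : NormCond H D f fun i => (q (N i)).t i := fun K => by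
    obtain ⟨M, hM⟩ := Filter.eventually_atTop.1 ((q K).norm_cond K)
    refine Filter.eventually_atTop.2 ⟨((q K).t M).mdn, fun i hi => ?_⟩
    by_contra! hc
    obtain ⟨j, hj⟩ := hrange K i (hc.trans (hf.cast_le (by omega) _))
    have h1 : i ≤ ((q (N i)).t i).mdn := (href 0).chain.strictMono.le_apply
    rw [← hj] at hc h1
    exact absurd (hM j ((q K).isChain.strictMono.le_iff_le.1 (hi.trans h1))) (not_lt.2 hc)
  refine ⟨QStar.mk' (q 0).stem _ (href 0).chain ((q 0).adm.of_ref (q 0).isChain (href 0)) hnorm,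
    fun n => ⟨⟨QStar.le_of_ref (href n) (hstem n), hstem n⟩, fun j hj => ?_, hrange n⟩⟩
  change (q n).t j = (q (N j)).t j
  rw [← hconst n j hj _ (le_max_left n (N j)), hev j _ (le_max_right n (N j))]

end QF

theorem Enters.of_lEn {E : Set (QF P f)} (hE : IsUpperSet E) {n : ℕ} {p q : QF P f}
    (h : QF.LEn n p q) (hp : Enters E p.stem p.t) : Enters E q.stem q.t := by
  rw [← h.le.2]
  exact hp.of_ref hE p.isChain p.adm (QStar.ref_of_le h.le.1 h.le.2) q.norm_cond

end Limits

/-! ### Deciding names, and clubs of countable sets -/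

section Deciding

variable {Q : Type u} [Preorder Q]

theorem OrdName.Forces.mono {τ : OrdName.{u, w} Q} {p q : Q} {o : Ordinal.{w}}
    (h : τ.Forces p o) (hpq : p ≤ q) : τ.Forces q o := fun r hr => h r (hpq.trans hr)

theorem OrdName.isUpperSet_decidedBy (τ : OrdName.{u, w} Q) : IsUpperSet {p | τ.DecidedBy p} :=
  fun _ _ hpq ⟨o, ho⟩ => ⟨o, ho.mono hpq⟩

theorem OrdName.isDenseSet_decidedBy (τ : OrdName.{u, w} Q) : IsDenseSet {p | τ.DecidedBy p} :=
  fun p => by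
    obtain ⟨r, hr, x, hx, hxr⟩ := τ.exists_value p
    exact ⟨r, ⟨x.2, fun q hq => ⟨q, le_rfl, x.1, hxr.trans hq, hx⟩⟩, hr⟩

end Deciding

section Clubs

variable {X : Type u}

/-- The countable sets closed under a countable-set-valued binary operation form a club. -/
theorem isCountableClub_closed {Φ : X → X → Set X} (hΦ : ∀ x y, (Φ x y).Countable) :
    IsCountableClub {A : Set X | A.Countable ∧ ∀ x ∈ A, ∀ y ∈ A, Φ x y ⊆ A} := by
  refine ⟨fun A hA => hA.1, fun A hA => ?_, fun A hA hAC => ⟨?_, ?_⟩⟩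
  · let step : Set X → Set X := fun S => S ∪ ⋃ x ∈ S, ⋃ y ∈ S, Φ x y
    have hmono : Monotone fun n => step^[n] A := monotone_nat_of_le_succ fun n => by
      rw [Function.iterate_succ_apply']
      exact Set.subset_union_left
    have hcount : ∀ n, (step^[n] A).Countable := fun n => by
      induction n with
      | zero => exact hA
      | succ n ih =>
        rw [Function.iterate_succ_apply']
        exact ih.union (ih.biUnion fun x _ => ih.biUnion fun y _ => hΦ x y)
    refine ⟨⋃ n, step^[n] A, ⟨Set.countable_iUnion hcount, fun x hx y hy z hz => ?_⟩,
      Set.subset_iUnion (fun n => step^[n] A) 0⟩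
    obtain ⟨m, hm⟩ := Set.mem_iUnion.1 hx
    obtain ⟨n, hn⟩ := Set.mem_iUnion.1 hy
    refine Set.mem_iUnion.2 ⟨max m n + 1, ?_⟩
    rw [Function.iterate_succ_apply']
    exact Or.inr (Set.mem_biUnion (hmono (le_max_left m n) hm)
      (Set.mem_biUnion (hmono (le_max_right m n) hn) hz))
  · exact Set.countable_iUnion fun n => (hAC n).1
  · intro x hx y hy
    obtain ⟨m, hm⟩ := Set.mem_iUnion.1 hx
    obtain ⟨n, hn⟩ := Set.mem_iUnion.1 hy
    exact ((hAC (max m n)).2 x (hA (le_max_left m n) hm) y (hA (le_max_right m n) hn)).trans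
      (Set.subset_iUnion A _)

end Clubs

/-! ### Properness -/

section Properness

variable {α : Type u} {H : ℕ → Set α} {D : Type v} {P : CreatingPair H D} {f : ℕ → ℕ → ℕ}

/-- Lengthen the stem of `q` past level `m` of `p`; smoothness then cuts it there. -/
theorem QF.exists_tail_le {p q : QF P f} (h : p ≤ q) (m : ℕ) :
    ∃ (y : List α) (hy : y ∈ pos P.Sg p.stem (seg p.t 0 m)) (r : QF P f),
      q ≤ r ∧ p.tail m y hy ≤ r := by
  obtain ⟨b, hb, hbst⟩ := QStar.exists_cuts_of_le h
  obtain ⟨z, hz⟩ := q.adm.pos_nonempty q.isChain m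
  have hbm : m ≤ b m := hb.strictMono.le_apply
  have hz' := p.isChain.pos_trans (Nat.zero_le _) (hb.strictMono.monotone (Nat.zero_le m)) hbst
    (hb.pos_subset p.isChain (Nat.zero_le m) hz)
  obtain ⟨h1, h2⟩ := p.adm.smooth p.isChain hbm hz'
  refine ⟨_, h1, q.tail m z hz, q.le_tail hz, QStar.le_of_cuts (hb.shift m hbm) ?_⟩
  change z ∈ pos P.Sg _ (seg (shift p.t m) 0 (b (m + 0) - m))
  rw [seg_shift, add_zero, Nat.add_sub_cancel' hbm]
  exact h2

/-- The conditions which extend an element of `A`. -/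
def above {Q : Type*} [Preorder Q] (A : Set Q) : Set Q := {r | ∃ d ∈ A, d ≤ r}

/-- Finitely many tails of `q` at one level each extend an element of `A`, and every extension of
`q` is compatible with one of them. -/
theorem Enters.exists_countable_predense (hH : IsFinitarySeq H) {A : Set (QF P f)} {q : QF P f}
    (h : Enters (above A) q.stem q.t) :
    ∃ W ⊆ A, W.Countable ∧ ∀ r, q ≤ r → ∃ d ∈ W, ∃ s, r ≤ s ∧ d ≤ s := by
  obtain ⟨m, hm⟩ := h
  have hd : ∀ y ∈ pos P.Sg q.stem (seg q.t 0 m), ∃ d ∈ A, ∀ hy, d ≤ q.tail m y hy := by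
    intro y hy
    obtain ⟨r, ⟨d, hdA, hdr⟩, hr, hrt⟩ := hm y hy
    obtain rfl : r = q.tail m y hy := QStar.ext hr hrt
    exact ⟨d, hdA, fun _ => hdr⟩
  have : Nonempty (QF P f) := ⟨q⟩
  choose! d hdA hd using hd
  refine ⟨d '' pos P.Sg q.stem (seg q.t 0 m), ?_, ?_, fun r hr => ?_⟩
  · rintro _ ⟨y, hy, rfl⟩
    exact hdA y hy
  · exact (((seqs_finite hH _).subset (q.adm.pos_subset_seqs q.isChain m)).countable).image d
  · obtain ⟨y, hy, s, hrs, hs⟩ := QF.exists_tail_le hr m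
    exact ⟨d y, ⟨y, hy, rfl⟩, s, hrs, (hd y hy hy).trans hs⟩

/-- The club consists of the countable sets closed under a choice `F` of fusion steps and `W` of
predense sets. A fusion through the dense sets in `N` stays in `N`; its limit may lie outside, but
the witnesses of genericity, taken from `W`, lie in `N`. -/
theorem isProperForcing_QF (hf : IsFast f) (hH : IsFinitarySeq H)
    (hmain : ∀ E : Set (QF P f), IsUpperSet E → IsDenseSet E → ∀ (p : QF P f) (k : ℕ),
      ∃ q : QF P f, QF.LEn (k + 1) p q ∧ Enters E q.stem q.t) :
    IsProperForcing (QF P f) := by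
  have hex : ∀ (p : QF P f) (A : Set (QF P f)) (k : ℕ), IsDenseSet A →
      ∃ (q : QF P f) (W : Set (QF P f)), QF.LEn (k + 1) p q ∧ W ⊆ A ∧ W.Countable ∧
        ∀ r, q ≤ r → ∃ d ∈ W, ∃ s, r ≤ s ∧ d ≤ s := by
    intro p A k hA
    obtain ⟨q, hq, hqA⟩ := hmain (above A)
      (fun a b hab ⟨d, hd, hda⟩ => ⟨d, hd, hda.trans hab⟩)
      (fun p => by
        obtain ⟨d, hd, hpd⟩ := hA p
        exact ⟨d, ⟨d, hd, le_rfl⟩, hpd⟩) p k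
    obtain ⟨W, hW⟩ := hqA.exists_countable_predense hH
    exact ⟨q, W, hq, hW⟩
  have : ∀ p : QF P f, Nonempty (QF P f) := fun p => ⟨p⟩
  choose! F W hF hWA hWc hW using hex
  let Φ : QF P f ⊕ Set (QF P f) → QF P f ⊕ Set (QF P f) → Set (QF P f ⊕ Set (QF P f)) :=
    fun x y => {z | ∃ p A k, x = Sum.inl p ∧ y = Sum.inr A ∧ IsDenseSet A ∧
      (z = Sum.inl (F p A k) ∨ z ∈ Sum.inl '' W p A k)}
  have hΦ : ∀ x y, (Φ x y).Countable := by
    rintro (p | B) (q | A)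
    · refine Set.countable_empty.mono ?_
      rintro z ⟨p, A, k, _, h, _⟩
      cases h
    · by_cases hA : IsDenseSet A
      · refine (Set.countable_iUnion fun k =>
          (Set.countable_singleton (Sum.inl (F p A k))).union ((hWc p A k hA).image Sum.inl)).mono ?_
        rintro z ⟨p', A', k, hp, hA', _, hz⟩
        cases hp
        cases hA'
        exact Set.mem_iUnion.2 ⟨k, hz⟩
      · refine Set.countable_empty.mono ?_
        rintro z ⟨p', A', k, _, h, hA', _⟩
        cases h
        exact absurd hA' hA
    all_goals
      refine Set.countable_empty.mono ?_
      rintro z ⟨p, A, k, h, _⟩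
      cases h
  refine ⟨_, isCountableClub_closed hΦ, fun N hN p hp => ?_⟩
  set 𝒜 : Set (Set (QF P f)) := {A | Sum.inr A ∈ N ∧ IsDenseSet A}
  rcases 𝒜.eq_empty_or_nonempty with h𝒜 | h𝒜
  · refine ⟨p, le_rfl, fun A hA hA' => ?_⟩
    have : A ∈ 𝒜 := ⟨hA, hA'⟩
    rw [h𝒜] at this
    exact absurd this (Set.notMem_empty A)
  have hc : 𝒜.Countable := (hN.1.preimage Sum.inr_injective).mono fun A hA => hA.1
  obtain ⟨e, he⟩ := hc.exists_eq_range h𝒜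
  have he' : ∀ n, e n ∈ 𝒜 := fun n => he ▸ ⟨n, rfl⟩
  obtain ⟨q, hq0, hqN, hq⟩ := exists_seq_of_forall_exists
    (I := fun _ (q : QF P f) => (Sum.inl q : QF P f ⊕ Set (QF P f)) ∈ N)
    (R := fun n q q' => q' = F q (e n) n) (x₀ := p) hp
    (fun n q hq => ⟨_, hN.2 _ hq _ (he' n).1
      ⟨q, e n, n, rfl, rfl, (he' n).2, Or.inl rfl⟩, rfl⟩)
  obtain ⟨r, hr⟩ := QF.exists_lEn_limit hf (k := 0) (q := q) fun n => by
    rw [hq n, zero_add]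
    exact hF _ _ _ (he' n).2
  refine ⟨r, hq0 ▸ (hr 0).le.1, fun A hA hA' s hs => ?_⟩
  obtain ⟨n, rfl⟩ : A ∈ Set.range e := he ▸ ⟨hA, hA'⟩
  obtain ⟨d, hd, hds⟩ := hW (q n) (e n) n hA' s (hq n ▸ (hr (n + 1)).le.1.trans hs)
  exact ⟨d, hWA _ _ _ hA' hd, hN.2 _ (hqN n) _ hA
    ⟨q n, e n, n, rfl, rfl, hA', Or.inr ⟨d, hd, rfl⟩⟩, hds⟩

end Properness

end Creatures

theorem mainTheorem10 {α : Type u} {H : ℕ → Set α} {D : Type v}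
    (hH : ∀ m, (H m).Nontrivial)
    (P : Creatures.CreatingPair H D) (hfin : P.IsFinitary)
    (hbig : P.IsBig fun _ => 2) (hhalf : P.HasHalving)
    (hsg : P.IsSimple ∨ P.IsGluing)
    (f : ℕ → ℕ → ℕ) (hf : Creatures.IsHFast H f) :
    (∀ (τ : ℕ → Creatures.OrdName.{max u v, w} (Creatures.QF P f))
        (p : Creatures.QF P f) (n : ℕ),
      ∃ q : Creatures.QF P f, Creatures.QF.LEn n p q ∧ ∀ m, q.EssentiallyDecides (τ m)) ∧
    Creatures.IsProperForcing (Creatures.QF P f) := by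
  have hmain : ∀ E : Set (Creatures.QF P f), IsUpperSet E → Creatures.IsDenseSet E →
      ∀ (p : Creatures.QF P f) (k : ℕ), ∃ q : Creatures.QF P f,
        Creatures.QF.LEn (k + 1) p q ∧ Creatures.Enters E q.stem q.t :=
    fun E hE hd p k => Creatures.exists_lEn_enters hH hbig hhalf hf hE hd p k
  refine ⟨fun τ p n => ?_, Creatures.isProperForcing_QF hf.1 hfin.1 hmain⟩
  obtain ⟨q, hq0, _, hq⟩ := Creatures.exists_seq_of_forall_exists (I := fun _ _ => True)
    (R := fun m (q q' : Creatures.QF P f) => Creatures.QF.LEn (n + m + 1) q q' ∧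
      Creatures.Enters {r | (τ m).DecidedBy r} q'.stem q'.t) (x₀ := p) trivial
    (fun m q _ => by
      obtain ⟨q', hq'⟩ := hmain _ (τ m).isUpperSet_decidedBy (τ m).isDenseSet_decidedBy q (n + m)
      exact ⟨q', trivial, hq'⟩)
  obtain ⟨r, hr⟩ := Creatures.QF.exists_lEn_limit hf.1 fun m => (hq m).1
  -- The index must grow along the fusion and starts at `n + 1`; lowering it by one also covers `n =
  -- 0`.
  refine ⟨r, hq0 ▸ Creatures.QF.LEn.pred hf.1 (hr 0), fun m => ?_⟩
  obtain ⟨j, hj⟩ := (hq m).2.of_lEn (τ m).isUpperSet_decidedBy (hr (m + 1))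
  refine ⟨j, fun x hx => ?_⟩
  obtain ⟨r', hr', hst, ht⟩ := hj x hx
  exact ⟨r', hst, fun i => by rw [ht, Creatures.shift_apply], hr'⟩
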